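/- Let $n\ge 0$. A vacillating tableau of empty shape and length $2n$ is a sequence $(\lambda^0,\dots,\lambda^{2n})$ of integer partitions with $\lambda^0=\lambda^{2n}=\emptyset$ such that, for $0\le i<n$, $\lambda^{2i+1}$ is $\lambda^{2i}$ or $\lambda^{2i}$ with one square deleted, and $\lambda^{2i+2}$ is $\lambda^{2i+1}$ or $\lambda^{2i+1}$ with one square added. Let $\mathcal{VT}_n$ be the set of these, let $\Pi_n$ be the set of set partitions of $\{1,\dots,n\}$, and let $\tau_n:\mathcal{VT}_n\to\mathcal{VT}_n$ be the map that conjugates every $\lambda^i$. The Chen--Deng--Du--Stanley--Yan map $\varphi_n:\Pi_n\to\mathcal{VT}_n$ sends $\pi$ to the sequence of shapes of the tableaux $T_0,\dots,T_{2n}$ obtained as follows. The arcs of $\pi$ are the pairs $(i,j)$, $i<j$, of consecutive elements of a block. Start with $T_{2n}=\emptyset$. For $j=n,n-1,\dots,1$: $T_{2j-1}$ is $T_{2j}$ with the entry $j$ removed if $j$ is the left endpoint of an arc, and $T_{2j}$ otherwise; $T_{2j-2}$ is obtained from $T_{2j-1}$ by RSK row insertion of $i$ if there is an arc $(i,j)$,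 and is $T_{2j-1}$ otherwise. Define the odd Fibonacci numbers $F_{2n-1}:=a_n$ by $a_0=a_1=1$ and $a_n=3a_{n-1}-a_{n-2}$ for $n\ge2$; for $n\ge1$ this is the usual Fibonacci number with index $2n-1$. Then: 1. $\varphi_n$ is a well-defined bijection, and the involution $\varphi_n^{-1}\circ\tau_n\circ\varphi_n$ of $\Pi_n$ has exactly $F_{2n-1}$ fixed points. 2. The fixed points of $\tau_n$ are exactly the $(\lambda^0,\dots,\lambda^{2n})\in\mathcal{VT}_n$ in which every $\lambda^i$ is $\emptyset$ or $(1)$. 3. These are in bijection with the Motzkin paths of length $n$ and height at most $1$ in which every level step at height $1$ carries a label $0$ or $1$. A bijection is given by letting the height at abscissa $i$ be $0$ if $\lambda^{2i}=\emptyset$ and $1$ if $\lambda^{2i}=(1)$, and by giving a level step at height $1$ from $i-1$ to $i$ the label $0$ if $\lambda^{2i-1}=(1)$ and $1$ if $\lambda^{2i-1}=\emptyset$. -/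

import Mathlib

/-! ### Set partitions and vacillating tableaux -/

/-- Set partitions of `[n] = {1, …, n}`. -/
abbrev SetPartition (n : ℕ) : Type := Finpartition (Finset.Icc 1 n)

/-- `μ` is obtained from `l` by adding one square
(equivalently, `l` is obtained from `μ` by deleting one square). -/
def AddsSquare (l μ : YoungDiagram) : Prop :=
  ∃ c, c ∉ l.cells ∧ μ.cells = insert c l.cells

/-- Vacillating tableaux of shape `l` and length `2 n`: sequences
`∅ = λ⁰, λ¹, …, λ²ⁿ = l` of integer partitions (as Young diagrams) such that `λ²ⁱ⁺¹` is `λ²ⁱ` or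
`λ²ⁱ` with one square deleted, and `λ²ⁱ⁺²` is `λ²ⁱ⁺¹` or `λ²ⁱ⁺¹` with one square added. -/
@[ext]
structure VacillatingTableau (n : ℕ) (l : YoungDiagram) where
  shape : Fin (2 * n + 1) → YoungDiagram
  shape_zero : shape 0 = ⊥
  shape_last : shape (Fin.last (2 * n)) = l
  odd_step : ∀ i : Fin n,
    shape ⟨2 * i + 1, by omega⟩ = shape ⟨2 * i, by omega⟩ ∨
      AddsSquare (shape ⟨2 * i + 1, by omega⟩) (shape ⟨2 * i, by omega⟩)
  even_step : ∀ i : Fin n,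
    shape ⟨2 * i + 2, by omega⟩ = shape ⟨2 * i + 1, by omega⟩ ∨
      AddsSquare (shape ⟨2 * i + 1, by omega⟩) (shape ⟨2 * i + 2, by omega⟩)

theorem AddsSquare.transpose {l μ : YoungDiagram} (h : AddsSquare l μ) :
    AddsSquare l.transpose μ.transpose := by
  obtain ⟨c, hc, h⟩ := h
  refine ⟨c.swap, ?_, ?_⟩
  · rw [YoungDiagram.mem_cells, YoungDiagram.mem_transpose, Prod.swap_swap]
    simpa using hc
  · ext x
    have hx : x.swap ∈ μ.cells ↔ x.swap = c ∨ x.swap ∈ l.cells := by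
      rw [h, Finset.mem_insert]
    have hs : x.swap = c ↔ x = c.swap := Prod.swap_eq_iff_eq_swap
    simp only [YoungDiagram.mem_cells, YoungDiagram.mem_transpose, Finset.mem_insert] at hx ⊢
    rw [hx, hs]

theorem YoungDiagram.transpose_bot' : (⊥ : YoungDiagram).transpose = ⊥ := by
  ext x
  simp

/-- The map `τ` on vacillating tableaux of empty shape which conjugates every partition in the
sequence. -/
def conjugateTableau {n : ℕ} (V : VacillatingTableau n ⊥) : VacillatingTableau n ⊥ where
  shape i := (V.shape i).transpose
  shape_zero := by rw [V.shape_zero, YoungDiagram.transpose_bot']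
  shape_last := by rw [V.shape_last, YoungDiagram.transpose_bot']
  odd_step i := (V.odd_step i).imp (fun h => by rw [h]) AddsSquare.transpose
  even_step i := (V.even_step i).imp (fun h => by rw [h]) AddsSquare.transpose

/-! ### The Chen–Deng–Du–Stanley–Yan map from set partitions to vacillating tableaux

Tableaux are lists of rows, rows are lists of entries. The arcs of a set partition are the pairs
`(i, j)` of consecutive elements of a block, `i < j`. -/

/-- Row insertion (Robinson–Schensted–Knuth) of `x` into a tableau: in the first row `x` replaces
the leftmost entry `y > x`, and `y` is then inserted into the rows below; if there is no such entry,
then `x` is put at the end of the row. -/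
def rowInsert : ℕ → List (List ℕ) → List (List ℕ)
  | x, [] => [[x]]
  | x, r :: t =>
    match r.find? (fun y => decide (x < y)) with
    | none => (r ++ [x]) :: t
    | some y => r.replace y x :: rowInsert y t

/-- Remove the square with entry `j` from a tableau (in the use below `j` is its largest entry). -/
def removeEntry (j : ℕ) (T : List (List ℕ)) : List (List ℕ) :=
  (T.map fun r => r.erase j).filter fun r => !r.isEmpty

/-- If `j` is the left endpoint of an arc, remove `j` from the tableau; else do nothing. -/
def deleteStep {n : ℕ} (P : SetPartition n) (j : ℕ) (T : List (List ℕ)) : List (List ℕ) :=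
  if ((P.part j).filter fun k => j < k).Nonempty then removeEntry j T else T

/-- If `j` is the right endpoint of an arc `(i, j)`, insert `i` into the tableau; else do
nothing. -/
def insertStep {n : ℕ} (P : SetPartition n) (j : ℕ) (T : List (List ℕ)) : List (List ℕ) :=
  if h : ((P.part j).filter fun i => i < j).Nonempty then
    rowInsert (((P.part j).filter fun i => i < j).max' h) T
  else T

/-- The tableau reached from the empty tableau after reading the `k` numbers
`j = n, n - 1, …, n - k + 1`, in this order, doing for each `j` first the deletion step and then the
insertion step. -/
def cddsyRead {n : ℕ} (P : SetPartition n) : ℕ → List (List ℕ)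
  | 0 => []
  | k + 1 => insertStep P (n - k) (deleteStep P (n - k) (cddsyRead P k))

/-- The tableaux `T₀, …, T₂ₙ` of a set partition: `T₂ₙ = ∅`, and reading `j = n, …, 1`,
`T₂ⱼ₋₁` is `T₂ⱼ` after the deletion step for `j`, and `T₂ⱼ₋₂` is `T₂ⱼ₋₁` after the insertion step
for `j`. -/
def cddsyTableau {n : ℕ} (P : SetPartition n) (m : ℕ) : List (List ℕ) :=
  if m % 2 = 0 then cddsyRead P (n - m / 2)
  else deleteStep P (m / 2 + 1) (cddsyRead P (n - (m / 2 + 1)))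

/-- `φ` is the Chen–Deng–Du–Stanley–Yan map: the `m`-th partition of `φ P` is the shape of the
tableau `Tₘ` of `P` (`rowLens` is the list of the nonzero parts of a partition). -/
def IsCDDSYMap {n : ℕ} (φ : SetPartition n → VacillatingTableau n ⊥) : Prop :=
  ∀ (P : SetPartition n) (m : Fin (2 * n + 1)),
    ((φ P).shape m).rowLens = (cddsyTableau P m).map List.length

/-! ### Odd Fibonacci numbers, and Motzkin paths -/

/-- The odd Fibonacci numbers `F₂ₙ₋₁`: `F₋₁ = F₁ = 1` and `F₂ₙ₊₃ = 3 F₂ₙ₊₁ - F₂ₙ₋₁`. -/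
def oddFib : ℕ → ℤ
  | 0 => 1
  | 1 => 1
  | n + 2 => 3 * oddFib (n + 1) - oddFib n

/-- The Young diagram of the partition `(1)`. -/
def oneSquare : YoungDiagram where
  cells := {(0, 0)}
  isLowerSet := by
    intro a b hba ha
    have h : a = (0, 0) := by simpa using ha
    subst h
    have h0 : b = (0, 0) := le_antisymm hba ⟨Nat.zero_le _, Nat.zero_le _⟩
    simp [h0]

/-- The vacillating tableaux of empty shape and length `2 n` all of whose partitions are `∅` or
`(1)`. -/
def flatTableaux (n : ℕ) : Set (VacillatingTableau n ⊥) :=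
  {V | ∀ i, V.shape i = ⊥ ∨ V.shape i = oneSquare}

/-- Motzkin paths of length `n`, given by their heights `h₀, …, hₙ ∈ ℕ`. -/
@[ext]
structure MotzkinPath (n : ℕ) where
  height : Fin (n + 1) → ℕ
  height_zero : height 0 = 0
  height_last : height (Fin.last n) = 0
  step : ∀ i : Fin n, height i.succ = height i.castSucc + 1 ∨
    height i.succ = height i.castSucc ∨ height i.succ + 1 = height i.castSucc

/-- Motzkin paths of length `n` and height at most `1`, in which every level step at height `1`
carries a label `0` or `1` (and no other step carries a label). -/
@[ext]
structure ColouredMotzkinPath (n : ℕ) extends MotzkinPath n where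
  height_le : ∀ i, height i ≤ 1
  label : Fin n → Option (Fin 2)
  label_isSome : ∀ i : Fin n,
    (label i).isSome ↔ height i.castSucc = 1 ∧ height i.succ = 1

open Classical in
/-- The path of a vacillating tableau with all shapes `∅` or `(1)`: the height at `i` is `0` or `1`
according to whether `λ²ⁱ` is `∅` or `(1)`, and a level step from `i` to `i + 1` at height `1` gets
the label `0` or `1` according to whether `λ²ⁱ⁺¹` is `(1)` or `∅`. -/
noncomputable def toMotzkin {n : ℕ} (V : flatTableaux n) : ColouredMotzkinPath n where
  height i := if V.1.shape ⟨2 * i, by omega⟩ = ⊥ then 0 else 1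
  height_zero := if_pos V.1.shape_zero
  height_last := if_pos V.1.shape_last
  step i := by split_ifs <;> simp
  height_le i := by split_ifs <;> simp
  label i :=
    if V.1.shape ⟨2 * i, by omega⟩ ≠ ⊥ ∧ V.1.shape ⟨2 * i + 2, by omega⟩ ≠ ⊥ then
      some (if V.1.shape ⟨2 * i + 1, by omega⟩ = ⊥ then 1 else 0)
    else none
  label_isSome i := by
    simp only [Fin.val_castSucc, Fin.val_succ, Nat.mul_add, Nat.mul_one]
    split_ifs <;> simp_all

/-!
Read forwards, `λ⁰, …, λ²ⁿ` determines the tableaux `T₀, …, T₂ₙ`: passing to an odd index either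
keeps the tableau or undoes a row insertion, which is determined by the square that disappears, and
passing to an even index `2i` either keeps it or puts the entry `i` into the new square, where `i`
is larger than all entries present. The arcs are recovered as the pairs `(i, j)` for which `i`
leaves the tableau in the step from `T₂ⱼ₋₂` to `T₂ⱼ₋₁`, and every sequence of shapes arises.

A sequence of self-conjugate partitions which starts at `∅` and changes by one square at a time
cannot get beyond `(1)`, as no self-conjugate partition has two squares. Between `∅` and `(1)`, the
number of ways to reach each of the two partitions after `m` steps is a Fibonacci number.
-/

theorem pairwise_append_cons_iff {α : Type*} {R : α → α → Prop} [IsTrans α R] {a b : List α}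
    {x : α} : (a ++ x :: b).Pairwise R ↔
      a.Pairwise R ∧ b.Pairwise R ∧ (∀ z ∈ a, R z x) ∧ ∀ z ∈ b, R x z := by
  simp only [List.pairwise_append, List.pairwise_cons, List.mem_cons, forall_eq_or_imp]
  constructor
  · rintro ⟨ha, ⟨hxb, hb⟩, hab⟩
    exact ⟨ha, hb, fun z hz => (hab z hz).1, hxb⟩
  · rintro ⟨ha, hb, hax, hxb⟩
    exact ⟨ha, ⟨hxb, hb⟩, fun z hz => ⟨hax z hz, fun w hw => _root_.trans (hax z hz) (hxb w hw)⟩⟩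

theorem append_cons_inj_of_lt {α : Type*} [Preorder α] {x x' y : α} {a a' b b' : List α}
    (hx : x < y) (hx' : x' < y) (hb : ∀ z ∈ b, y < z) (hb' : ∀ z ∈ b', y < z)
    (h : a ++ x :: b = a' ++ x' :: b') : a = a' ∧ x = x' ∧ b = b' := by
  rcases List.append_eq_append_iff.1 h with ⟨_ | ⟨z, c⟩, hc, hd⟩ | ⟨_ | ⟨z, c⟩, hc, hd⟩ <;>
    simp only [List.nil_append, List.append_nil, List.cons_append, List.cons.injEq] at hc hd
  · exact ⟨hc.symm, hd⟩
  · exact absurd (hb x' (by simp [hd.2])) hx'.not_gt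
  · exact ⟨hc, hd.1.symm, hd.2.symm⟩
  · exact absurd (hb' x (by simp [hd.2])) hx.not_gt

/-- The number of entries of the row `r` that are less than `v`. It expresses that columns increase
without indexing the squares, see `IsTableau`. -/
def countLT (r : List ℕ) (v : ℕ) : ℕ := r.countP (· < v)

section CountLT

variable {r s : List ℕ} {v w : ℕ}

@[simp] theorem countLT_nil (v : ℕ) : countLT [] v = 0 := rfl

@[simp] theorem countLT_append (r s : List ℕ) (v : ℕ) :
    countLT (r ++ s) v = countLT r v + countLT s v := List.countP_append

@[simp] theorem countLT_cons (x : ℕ) (r : List ℕ) (v : ℕ) :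
    countLT (x :: r) v = countLT r v + if x < v then 1 else 0 := by
  simp [countLT, List.countP_cons]

theorem countLT_mono (r : List ℕ) (h : v ≤ w) : countLT r v ≤ countLT r w :=
  List.countP_mono_left fun z _ hz => by simp only [decide_eq_true_eq] at hz ⊢; omega

theorem countLT_le_length (r : List ℕ) (v : ℕ) : countLT r v ≤ r.length := List.countP_le_length

theorem countLT_eq_length (h : ∀ z ∈ r, z < v) : countLT r v = r.length :=
  List.countP_eq_length.2 (by simpa using h)

theorem countLT_eq_zero (h : ∀ z ∈ r, v ≤ z) : countLT r v = 0 :=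
  List.countP_eq_zero.2 (by simpa using h)

theorem countLT_pos_iff : 0 < countLT r v ↔ ∃ z ∈ r, z < v := by
  simp [countLT, List.countP_pos_iff]

theorem countLT_succ_of_notMem (h : v ∉ r) : countLT r (v + 1) = countLT r v :=
  List.countP_congr fun z hz => by
    have : z ≠ v := ne_of_mem_of_not_mem hz h
    simp only [decide_eq_true_eq]; omega

theorem countLT_lt_countLT_of_mem (hv : v ∈ r) (h : v < w) : countLT r v < countLT r w := by
  obtain ⟨a, b, rfl⟩ := List.append_of_mem hv
  have ha := countLT_mono a h.le
  have hb := countLT_mono b h.le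
  simp only [countLT_append, countLT_cons, lt_irrefl, if_false, if_pos h]
  omega

theorem length_le_of_countLT_le (h : ∀ v, countLT s v ≤ countLT r v) : s.length ≤ r.length := by
  rw [← countLT_eq_length fun z hz => Nat.lt_succ_of_le (List.le_sum_of_mem hz)]
  exact (h _).trans (countLT_le_length r _)

theorem countLT_le_countLT_of_length_le (hr : ∀ z ∈ r, z < w) (hlen : s.length ≤ r.length)
    (h : ∀ v ≤ w, countLT s v ≤ countLT r v) (v : ℕ) : countLT s v ≤ countLT r v := by
  rcases le_or_gt v w with hv | hv
  · exact h v hv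
  · rw [countLT_eq_length fun z hz => (hr z hz).trans hv]
    exact (countLT_le_length s v).trans hlen

end CountLT

/-- Tableaux with pairwise distinct entries, as lists of rows. As the entries are distinct, columns
increase if and only if for every `v` each row has at most as many entries below `v` as the row
above it. -/
inductive IsTableau : List (List ℕ) → Prop
  | nil : IsTableau []
  | cons {r : List ℕ} {t : List (List ℕ)} (ne_nil : r ≠ []) (sorted : r.Pairwise (· < ·))
      (disjoint : r.Disjoint t.flatten)
      (dominates : ∀ v, countLT (t.headD []) v ≤ countLT r v) (tail : IsTableau t) :
      IsTableau (r :: t)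

/-- The shape of a tableau, as the list of its row lengths. -/
def rowLengths (T : List (List ℕ)) : List ℕ := T.map List.length

@[simp] theorem rowLengths_nil : rowLengths [] = [] := rfl

@[simp] theorem rowLengths_cons (r : List ℕ) (t : List (List ℕ)) :
    rowLengths (r :: t) = r.length :: rowLengths t := rfl

@[simp] theorem rowLengths_eq_nil {T : List (List ℕ)} : rowLengths T = [] ↔ T = [] :=
  List.map_eq_nil_iff

theorem mem_flatten_of_mem_headD {T : List (List ℕ)} {z : ℕ} (h : z ∈ T.headD []) :
    z ∈ T.flatten := by
  cases T <;> simp_all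

theorem length_headD_le_of_sortedGE {a : ℕ} {t : List (List ℕ)}
    (h : (a :: rowLengths t).SortedGE) : (t.headD []).length ≤ a := by
  cases t with
  | nil => simp
  | cons s t => exact (List.isChain_cons_cons.1 h.isChain).1

namespace IsTableau

variable {r : List ℕ} {t T : List (List ℕ)}

theorem rowLengths_pos (hT : IsTableau T) : ∀ a ∈ rowLengths T, 0 < a := by
  induction hT with
  | nil => simp
  | cons ne_nil _ _ _ _ ih =>
    simpa only [rowLengths_cons, List.forall_mem_cons] using ⟨List.length_pos_iff.2 ne_nil, ih⟩

theorem rowLengths_sorted (hT : IsTableau T) : (rowLengths T).SortedGE := by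
  rw [List.sortedGE_iff_isChain]
  induction hT with
  | nil => simp
  | @cons r t _ _ _ dominates _ ih =>
    cases t with
    | nil => simp
    | cons s t => exact List.isChain_cons_cons.2 ⟨length_le_of_countLT_le dominates, ih⟩

theorem exists_lt_of_mem (hT : IsTableau (r :: t)) {y : ℕ} (hy : y ∈ t.flatten) :
    ∃ x ∈ r, x < y := by
  induction t generalizing r with
  | nil => simp at hy
  | cons s t ih =>
    obtain _ | ⟨-, -, disjoint, dominates, tail⟩ := hT
    have exists_lt_of_mem_s : ∀ z ∈ s, ∃ x ∈ r, x < z := fun z hz => by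
      have hzr : z ∉ r := fun h => disjoint h (by simp [hz])
      rw [← countLT_pos_iff, ← countLT_succ_of_notMem hzr]
      exact (countLT_pos_iff.2 ⟨z, hz, z.lt_succ_self⟩).trans_le (dominates (z + 1))
    rcases List.mem_append.1 (List.flatten_cons ▸ hy) with hy | hy
    · exact exists_lt_of_mem_s y hy
    · obtain ⟨z, hz, hzy⟩ := ih tail hy
      obtain ⟨x, hx, hxz⟩ := exists_lt_of_mem_s z hz
      exact ⟨x, hx, hxz.trans hzy⟩

theorem eq_nil_of_forall_notMem (hT : IsTableau T) (h : ∀ z, z ∉ T.flatten) : T = [] := by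
  obtain _ | ⟨ne_nil, -, -, -, -⟩ := hT
  · rfl
  · obtain ⟨z, hz⟩ := List.exists_mem_of_ne_nil _ ne_nil
    exact absurd (by simp [hz]) (h z)

end IsTableau

/-- `m` is the list `l` of row lengths with one square added. -/
inductive AddsCell : List ℕ → List ℕ → Prop
  | nil : AddsCell [] [1]
  | here (a : ℕ) (l : List ℕ) : AddsCell (a :: l) ((a + 1) :: l)
  | there (a : ℕ) {l m : List ℕ} : AddsCell l m → AddsCell (a :: l) (a :: m)

theorem AddsCell.ne {l m : List ℕ} (h : AddsCell l m) : l ≠ m := by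
  induction h <;> simp_all

section RowInsert

variable {x y : ℕ} {r a b : List ℕ} {t T : List (List ℕ)}

theorem rowInsert_of_forall_le (h : ∀ z ∈ r, z ≤ x) :
    rowInsert x (r :: t) = (r ++ [x]) :: t := by
  rw [rowInsert, List.find?_eq_none.2 (by simpa using h)]

theorem rowInsert_of_bump (ha : ∀ z ∈ a, z ≤ x) (hxy : x < y) :
    rowInsert x ((a ++ y :: b) :: t) = (a ++ x :: b) :: rowInsert y t := by
  have hfind : (a ++ y :: b).find? (fun z => decide (x < z)) = some y := by
    rw [List.find?_append, List.find?_eq_none.2 (by simpa using ha)]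
    simp [hxy]
  have hya : y ∉ a := fun h => (ha y h).not_gt hxy
  rw [rowInsert, hfind]
  simp [List.replace_append, hya]

theorem forall_le_or_exists_bump (x : ℕ) (r : List ℕ) : (∀ z ∈ r, z ≤ x) ∨
    ∃ a y b, r = a ++ y :: b ∧ (∀ z ∈ a, z ≤ x) ∧ x < y := by
  cases h : r.find? (fun z => decide (x < z)) with
  | none => exact .inl (by simpa using h)
  | some y =>
    obtain ⟨hxy, a, b, rfl, ha⟩ := List.find?_eq_some_iff_append.1 h
    exact .inr ⟨a, y, b, rfl, by simpa using ha, by simpa using hxy⟩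

theorem rowInsert_induction {motive : ℕ → List (List ℕ) → List (List ℕ) → Prop}
    (nil : ∀ x, motive x [] [[x]])
    (append : ∀ x r t, (∀ z ∈ r, z ≤ x) → motive x (r :: t) ((r ++ [x]) :: t))
    (bump : ∀ x y a b t, (∀ z ∈ a, z ≤ x) → x < y → motive y t (rowInsert y t) →
      motive x ((a ++ y :: b) :: t) ((a ++ x :: b) :: rowInsert y t))
    (x : ℕ) (T : List (List ℕ)) : motive x T (rowInsert x T) := by
  induction T generalizing x with
  | nil => exact nil x
  | cons r t ih =>
    rcases forall_le_or_exists_bump x r with h | ⟨a, y, b, rfl, ha, hxy⟩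
    · rw [rowInsert_of_forall_le h]
      exact append x r t h
    · rw [rowInsert_of_bump ha hxy]
      exact bump x y a b t ha hxy (ih y)

theorem mem_flatten_rowInsert {z : ℕ} : z ∈ (rowInsert x T).flatten ↔ z = x ∨ z ∈ T.flatten := by
  refine rowInsert_induction (motive := fun x T U => z ∈ U.flatten ↔ z = x ∨ z ∈ T.flatten)
    (fun x => by simp) (fun x r t _ => ?_) (fun x y a b t _ _ ih => ?_) x T
  · simp only [List.flatten_cons, List.mem_append, List.mem_singleton]; tauto
  · simp only [List.flatten_cons, List.mem_append, List.mem_cons, ih]; tauto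

theorem addsCell_rowInsert (x : ℕ) (T : List (List ℕ)) :
    AddsCell (rowLengths T) (rowLengths (rowInsert x T)) :=
  rowInsert_induction (motive := fun _ T U => AddsCell (rowLengths T) (rowLengths U))
    (fun _ => .nil) (fun _ r t _ => by simpa using .here r.length (rowLengths t))
    (fun _ _ _ _ _ _ _ ih => by simpa using .there _ ih) x T

theorem mem_headD_rowInsert (x : ℕ) (T : List (List ℕ)) : x ∈ (rowInsert x T).headD [] :=
  rowInsert_induction (motive := fun x _ U => x ∈ U.headD []) (by simp) (by simp) (by simp) x T

theorem countLT_headD_le_rowInsert (x : ℕ) (T : List (List ℕ)) (v : ℕ) :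
    countLT (T.headD []) v ≤ countLT ((rowInsert x T).headD []) v := by
  refine rowInsert_induction
    (motive := fun _ T U => countLT (T.headD []) v ≤ countLT (U.headD []) v) (by simp) (by simp)
    (fun x y a b t _ hxy _ => ?_) x T
  simp only [List.headD_cons, countLT_append, countLT_cons]
  split_ifs <;> omega

theorem countLT_headD_rowInsert_of_le {v : ℕ} (hv : v ≤ x) (T : List (List ℕ)) :
    countLT ((rowInsert x T).headD []) v = countLT (T.headD []) v := by
  refine rowInsert_induction
    (motive := fun x T U => v ≤ x → countLT (U.headD []) v = countLT (T.headD []) v)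
    (fun x hv => ?_) (fun x r t _ hv => ?_) (fun x y a b t _ hxy _ hv => ?_) x T hv
  · simp [hv.not_gt]
  · simp [hv.not_gt]
  · simp [hv.not_gt, (hv.trans hxy.le).not_gt]

theorem countLT_headD_rowInsert_le_max (hT : (T.headD []).Pairwise (· < ·))
    (hx : x ∉ T.headD []) (v : ℕ) : countLT ((rowInsert x T).headD []) v ≤
      max (countLT (T.headD []) v) (countLT (T.headD []) x + 1) := by
  refine rowInsert_induction
    (motive := fun x T U => (T.headD []).Pairwise (· < ·) → x ∉ T.headD [] →
      countLT (U.headD []) v ≤ max (countLT (T.headD []) v) (countLT (T.headD []) x + 1))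
    (fun x _ _ => ?_) (fun x r t hr _ hx => ?_) (fun x y a b t ha hxy _ hs hx => ?_) x T hT hx
  · simp only [List.headD_cons, countLT_cons, List.headD_nil, countLT_nil]
    split_ifs <;> omega
  · have hrx : countLT r x = r.length :=
      countLT_eq_length fun z hz => (hr z hz).lt_of_ne (ne_of_mem_of_not_mem hz hx)
    have hrv := countLT_le_length r v
    simp only [List.headD_cons, countLT_append, countLT_cons, countLT_nil]
    split_ifs <;> omega
  · have hax : countLT a x = a.length :=
      countLT_eq_length fun z hz => (ha z hz).lt_of_ne fun e => hx (by simp [← e, hz])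
    have hav := countLT_le_length a v
    have hbv : v ≤ y → countLT b v = 0 := fun hv => countLT_eq_zero fun z hz =>
      hv.trans ((pairwise_append_cons_iff.1 hs).2.2.2 z hz).le
    simp only [List.headD_cons, countLT_append, countLT_cons]
    split_ifs <;> omega

theorem IsTableau.headD_sorted (hT : IsTableau T) : (T.headD []).Pairwise (· < ·) := by
  cases hT with
  | nil => simp
  | cons _ sorted => exact sorted

/-- The first row of the insertion of `y` into `t` can stay below the row from which `y` was
bumped: below `y` it has the same number of entries as `t`, and beyond `y` at most one more. -/
theorem countLT_headD_rowInsert_le_of_bump (ht : IsTableau t) (hy : y ∉ t.flatten) (hxy : x < y)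
    (h : ∀ v, countLT (t.headD []) v ≤ countLT (a ++ y :: b) v) (v : ℕ) :
    countLT ((rowInsert y t).headD []) v ≤ countLT (a ++ x :: b) v := by
  have hyx : countLT (a ++ y :: b) v ≤ countLT (a ++ x :: b) v := by
    simp only [countLT_append, countLT_cons]
    split_ifs <;> omega
  refine le_trans ?_ hyx
  rcases le_or_gt v y with hv | hv
  · exact (countLT_headD_rowInsert_of_le hv t).trans_le (h v)
  · have hyt : y ∉ t.headD [] := fun hyt => hy (mem_flatten_of_mem_headD hyt)
    refine (countLT_headD_rowInsert_le_max ht.headD_sorted hyt v).trans (max_le (h v) ?_)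
    exact (Nat.succ_le_succ (h y)).trans (countLT_lt_countLT_of_mem (by simp) hv)

theorem isTableau_rowInsert (hT : IsTableau T) (hx : x ∉ T.flatten) :
    IsTableau (rowInsert x T) := by
  refine rowInsert_induction (motive := fun x T U => IsTableau T → x ∉ T.flatten → IsTableau U)
    (fun x _ _ => .cons (by simp) (by simp) (by simp) (by simp) .nil)
    (fun x r t hr hT hx => ?_) (fun x y a b t ha hxy ih hT hx => ?_) x T hT hx
  all_goals
    obtain _ | ⟨-, sorted, disjoint, dominates, tail⟩ := hT
    simp only [List.flatten_cons, List.mem_append, List.mem_cons, not_or] at hx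
  · have hrx : ∀ z ∈ r, z < x := fun z hz => (hr z hz).lt_of_ne (ne_of_mem_of_not_mem hz hx.1)
    refine .cons (by simp) (pairwise_append_cons_iff.2 ⟨sorted, by simp, hrx, by simp⟩) ?_
      (fun v => (dominates v).trans (by simp)) tail
    exact List.disjoint_append_left.2 ⟨disjoint, List.singleton_disjoint.2 hx.2⟩
  · obtain ⟨sorted_a, sorted_b, hay, hyb⟩ := pairwise_append_cons_iff.1 sorted
    simp only [List.disjoint_append_left, List.disjoint_cons_left] at disjoint
    have hax : ∀ z ∈ a, z < x := fun z hz =>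
      (ha z hz).lt_of_ne (ne_of_mem_of_not_mem hz hx.1.1)
    refine .cons (by simp) (pairwise_append_cons_iff.2
        ⟨sorted_a, sorted_b, hax, fun z hz => hxy.trans (hyb z hz)⟩) ?_
      (countLT_headD_rowInsert_le_of_bump tail disjoint.2.1 hxy dominates) (ih tail disjoint.2.1)
    intro z hz hzu
    rw [List.mem_append, List.mem_cons] at hz
    rcases mem_flatten_rowInsert.1 hzu with rfl | hzt
    · rcases hz with hz | hz | hz
      exacts [(hay z hz).false, hxy.ne' hz, (hyb z hz).false]
    · rcases hz with hz | rfl | hz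
      exacts [disjoint.1 hz hzt, hx.2 hzt, disjoint.2.2 hz hzt]

theorem rowInsert_inj {x' : ℕ} {T' : List (List ℕ)} (hT : IsTableau T) (hT' : IsTableau T')
    (hl : rowLengths T = rowLengths T') (h : rowInsert x T = rowInsert x' T') :
    x = x' ∧ T = T' := by
  induction hT generalizing x x' T' with
  | nil =>
    obtain rfl := rowLengths_eq_nil.1 hl.symm
    exact ⟨by simpa [rowInsert] using h, rfl⟩
  | @cons r t _ sorted _ _ _ ih =>
    cases hT' with
    | nil => simp at hl
    | @cons r' t' _ sorted' _ _ tail' =>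
    simp only [rowLengths_cons, List.cons.injEq] at hl
    rcases forall_le_or_exists_bump x r with hr | ⟨a, y, b, rfl, ha, hxy⟩ <;>
      rcases forall_le_or_exists_bump x' r' with hr' | ⟨a', y', b', rfl, ha', hxy'⟩
    · rw [rowInsert_of_forall_le hr, rowInsert_of_forall_le hr', List.cons.injEq] at h
      obtain ⟨rfl, hx⟩ := List.append_inj' h.1 rfl
      exact ⟨List.singleton_inj.1 hx, by rw [h.2]⟩
    · rw [rowInsert_of_forall_le hr, rowInsert_of_bump ha' hxy', List.cons.injEq] at h
      have hlen := congrArg List.length h.1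
      simp only [List.length_append, List.length_cons, List.length_nil] at hlen hl
      omega
    · rw [rowInsert_of_bump ha hxy, rowInsert_of_forall_le hr', List.cons.injEq] at h
      have hlen := congrArg List.length h.1
      simp only [List.length_append, List.length_cons, List.length_nil] at hlen hl
      omega
    · rw [rowInsert_of_bump ha hxy, rowInsert_of_bump ha' hxy', List.cons.injEq] at h
      obtain ⟨rfl, rfl⟩ := ih tail' hl.2 h.2
      obtain ⟨rfl, rfl, rfl⟩ := append_cons_inj_of_lt hxy hxy'
        (pairwise_append_cons_iff.1 sorted).2.2.2 (pairwise_append_cons_iff.1 sorted').2.2.2 h.1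
      exact ⟨rfl, rfl⟩

theorem exists_eq_append_cons_of_lt (hr : r.Pairwise (· < ·)) (hy : y ∉ r) (h : ∃ x ∈ r, x < y) :
    ∃ a x b, r = a ++ x :: b ∧ x < y ∧ ∀ z ∈ b, y < z := by
  induction r with
  | nil => simp at h
  | cons c r ih =>
    obtain ⟨hcr, hr⟩ := List.pairwise_cons.1 hr
    obtain ⟨hyc, hyr⟩ := not_or.1 (mt List.mem_cons.2 hy)
    by_cases hlt : ∃ x ∈ r, x < y
    · obtain ⟨a, x, b, rfl, hxy, hb⟩ := ih hr hyr hlt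
      exact ⟨c :: a, x, b, rfl, hxy, hb⟩
    · push Not at hlt
      have hcy : c < y := by
        obtain ⟨x, hx, hxy⟩ := h
        rcases List.mem_cons.1 hx with rfl | hx
        exacts [hxy, (hcr x hx).trans hxy]
      exact ⟨[], c, r, rfl, hcy, fun z hz => (hlt z hz).lt_of_ne' (ne_of_mem_of_not_mem hz hyr)⟩

/-- Undoing a bump: the row `a ++ y :: b` still dominates `s` when the row `a ++ x :: b` dominates
`u`, where `u` is the insertion of `y` into `s`. -/
theorem countLT_le_of_unbump {s u : List ℕ} (ha : ∀ z ∈ a, z < x) (hb : ∀ z ∈ b, y < z)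
    (hxy : x < y) (hyu : y ∈ u) (hsu : ∀ v, countLT s v ≤ countLT u v)
    (hu : ∀ v, countLT u v ≤ countLT (a ++ x :: b) v) (v : ℕ) :
    countLT s v ≤ countLT (a ++ y :: b) v := by
  refine (hsu v).trans ?_
  by_cases hv : x < v ∧ v ≤ y
  · have hsucc : y ∉ a ++ x :: b := by
      simp only [List.mem_append, List.mem_cons, not_or]
      exact ⟨fun h => (ha y h).not_gt hxy, hxy.ne', fun h => (hb y h).false⟩
    have huv : countLT u v < countLT (a ++ x :: b) y := by
      rw [← countLT_succ_of_notMem hsucc]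
      exact ((countLT_mono u hv.2).trans_lt (countLT_lt_countLT_of_mem hyu y.lt_succ_self)).trans_le
        (hu (y + 1))
    have hay : countLT a y = countLT a v := by
      rw [countLT_eq_length fun z hz => (ha z hz).trans hxy,
        countLT_eq_length fun z hz => (ha z hz).trans hv.1]
    have hby : countLT b y = 0 := countLT_eq_zero fun z hz => (hb z hz).le
    simp only [countLT_append, countLT_cons] at huv ⊢
    split_ifs at * <;> omega
  · have huv := hu v
    simp only [countLT_append, countLT_cons] at huv ⊢
    split_ifs at * <;> omega

theorem IsTableau.of_append_singleton (h : IsTableau ((r ++ [x]) :: t)) (hr : r ≠ [])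
    (hlen : (t.headD []).length ≤ r.length) : IsTableau (r :: t) ∧ x ∉ (r :: t).flatten := by
  obtain _ | ⟨-, sorted, disjoint, dominates, tail⟩ := h
  obtain ⟨sorted_r, -, hrx, -⟩ := pairwise_append_cons_iff.1 sorted
  rw [List.disjoint_append_left, List.singleton_disjoint] at disjoint
  refine ⟨.cons hr sorted_r disjoint.1
    (countLT_le_countLT_of_length_le hrx hlen fun v hv => ?_) tail, ?_⟩
  · simpa [hv.not_gt] using dominates v
  · rw [List.flatten_cons, List.mem_append, not_or]
    exact ⟨fun h => (hrx x h).false, disjoint.2⟩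

theorem IsTableau.of_bump (h : IsTableau ((a ++ x :: b) :: rowInsert y t))
    (ht : IsTableau t) (hyt : y ∉ t.flatten) (hxy : x < y) (hb : ∀ z ∈ b, y < z) :
    IsTableau ((a ++ y :: b) :: t) ∧ x ∉ ((a ++ y :: b) :: t).flatten := by
  obtain _ | ⟨-, sorted, disjoint, dominates, -⟩ := h
  obtain ⟨sorted_a, sorted_b, hax, hxb⟩ := pairwise_append_cons_iff.1 sorted
  have disjoint_t : (a ++ x :: b).Disjoint t.flatten := fun z hz hzt =>
    disjoint hz (mem_flatten_rowInsert.2 (.inr hzt))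
  rw [List.disjoint_append_left, List.disjoint_cons_left] at disjoint_t
  refine ⟨.cons (by simp) (pairwise_append_cons_iff.2
      ⟨sorted_a, sorted_b, fun z hz => (hax z hz).trans hxy, hb⟩)
    (List.disjoint_append_left.2 ⟨disjoint_t.1, List.disjoint_cons_left.2 ⟨hyt, disjoint_t.2.2⟩⟩)
    (countLT_le_of_unbump hax hb hxy (mem_headD_rowInsert y t) (countLT_headD_le_rowInsert y t)
      dominates) ht, ?_⟩
  simp only [List.flatten_cons, List.mem_append, List.mem_cons, not_or]
  exact ⟨⟨fun h => (hax x h).false, hxy.ne, fun h => (hxb x h).false⟩, disjoint_t.2.1⟩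

theorem exists_rowInsert_eq {l : List ℕ} {U : List (List ℕ)} (h : AddsCell l (rowLengths U))
    (hl : l.SortedGE) (hpos : ∀ a ∈ l, 0 < a) (hU : IsTableau U) :
    ∃ x T, rowInsert x T = U ∧ IsTableau T ∧ x ∉ T.flatten ∧ rowLengths T = l := by
  induction hU generalizing l with
  | nil => cases h
  | @cons r t ne_nil sorted disjoint dominates tail ih =>
    have hU := IsTableau.cons ne_nil sorted disjoint dominates tail
    rw [rowLengths_cons] at h
    generalize hr : r.length = m, ht : rowLengths t = m' at h
    cases h with
    | nil =>
      obtain ⟨x, rfl⟩ := List.length_eq_one_iff.1 hr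
      exact ⟨x, [], by rw [rowLengths_eq_nil.1 ht, rowInsert], .nil, by simp, rfl⟩
    | here a =>
      subst ht
      obtain ⟨r, x, rfl⟩ := (List.eq_nil_or_concat' r).resolve_left ne_nil
      obtain rfl : r.length = a := by simpa using hr
      have hr_ne : r ≠ [] := List.length_pos_iff.1 (hpos _ (by simp))
      obtain ⟨hT, hx⟩ := hU.of_append_singleton hr_ne (length_headD_le_of_sortedGE hl)
      have hrx := (pairwise_append_cons_iff.1 sorted).2.2.1
      exact ⟨x, r :: t, rowInsert_of_forall_le fun z hz => (hrx z hz).le, hT, hx, rfl⟩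
    | there a h =>
      subst ht hr
      obtain ⟨y, t, rfl, ht, hyt, rfl⟩ := ih h hl.isChain.of_cons.sortedGE
        fun a ha => hpos a (by simp [ha])
      have hy : y ∈ (rowInsert y t).flatten := mem_flatten_rowInsert.2 (.inl rfl)
      obtain ⟨a, x, b, rfl, hxy, hb⟩ := exists_eq_append_cons_of_lt sorted
        (fun h => disjoint h hy) (hU.exists_lt_of_mem hy)
      obtain ⟨hT, hx⟩ := hU.of_bump ht hyt hxy hb
      have hax := (pairwise_append_cons_iff.1 sorted).2.2.1
      exact ⟨x, (a ++ y :: b) :: t, rowInsert_of_bump (fun z hz => (hax z hz).le) hxy, hT, hx,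
        by simp⟩

end RowInsert

/-- `T` is `S` with the entry `j` appended to one of the rows, possibly an empty row below `S`. -/
inductive AppendsEntry (j : ℕ) : List (List ℕ) → List (List ℕ) → Prop
  | nil : AppendsEntry j [] [[j]]
  | here (r : List ℕ) (t : List (List ℕ)) : AppendsEntry j (r :: t) ((r ++ [j]) :: t)
  | there (r : List ℕ) {t u : List (List ℕ)} : AppendsEntry j t u → AppendsEntry j (r :: t) (r :: u)

theorem removeEntry_cons {j : ℕ} {r s : List ℕ} (t : List (List ℕ)) (hr : r.erase j = s)
    (hs : s ≠ []) : removeEntry j (r :: t) = s :: removeEntry j t := by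
  simp [removeEntry, hr, hs]

theorem removeEntry_of_notMem {j : ℕ} {S : List (List ℕ)} (hS : IsTableau S)
    (hj : j ∉ S.flatten) : removeEntry j S = S := by
  induction hS with
  | nil => rfl
  | cons ne_nil _ _ _ _ ih =>
    rw [List.flatten_cons, List.mem_append, not_or] at hj
    rw [removeEntry_cons _ (List.erase_of_not_mem hj.1) ne_nil, ih hj.2]

namespace AppendsEntry

variable {j : ℕ} {S T T' : List (List ℕ)}

theorem addsCell (h : AppendsEntry j S T) : AddsCell (rowLengths S) (rowLengths T) := by
  induction h with
  | nil => exact .nil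
  | here r t => simpa using .here r.length (rowLengths t)
  | there r _ ih => exact .there r.length ih

theorem mem_flatten_iff (h : AppendsEntry j S T) {z : ℕ} :
    z ∈ T.flatten ↔ z = j ∨ z ∈ S.flatten := by
  induction h with
  | nil => simp
  | here r t => simp only [List.flatten_cons, List.mem_append, List.mem_singleton]; tauto
  | there r _ ih => simp only [List.flatten_cons, List.mem_append, ih]; tauto

theorem unique (h : AppendsEntry j S T) (h' : AppendsEntry j S T')
    (hl : rowLengths T = rowLengths T') : T = T' := by
  induction h generalizing T' with
  | nil => cases h'; rfl
  | here r t =>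
    cases h' with
    | here => rfl
    | there => simp at hl
  | there r _ ih =>
    cases h' with
    | here => simp at hl
    | there _ h' => rw [ih h' (List.cons.inj hl).2]

theorem exists_of_addsCell (j : ℕ) {m : List ℕ} (h : AddsCell (rowLengths S) m) :
    ∃ T, AppendsEntry j S T ∧ rowLengths T = m := by
  induction S generalizing m with
  | nil => cases h; exact ⟨_, .nil, rfl⟩
  | cons r t ih =>
    rw [rowLengths_cons] at h
    cases h with
    | here => exact ⟨_, .here r t, by simp⟩
    | there _ h =>
      obtain ⟨u, hu, rfl⟩ := ih h
      exact ⟨_, .there r hu, rfl⟩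

theorem countLT_headD_of_le (h : AppendsEntry j S T) {v : ℕ} (hv : v ≤ j) :
    countLT (T.headD []) v = countLT (S.headD []) v := by
  cases h <;> simp [hv.not_gt]

theorem countLT_headD_le (h : AppendsEntry j S T) (v : ℕ) :
    countLT (S.headD []) v ≤ countLT (T.headD []) v := by
  cases h <;> simp

theorem isTableau (h : AppendsEntry j S T) (hS : IsTableau S) (hj : ∀ z ∈ S.flatten, z < j)
    (hT : (rowLengths T).SortedGE) : IsTableau T := by
  induction h with
  | nil => exact .cons (by simp) (by simp) (by simp) (by simp) .nil
  | here r t =>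
    obtain _ | ⟨-, sorted, disjoint, dominates, tail⟩ := hS
    simp only [List.flatten_cons, List.mem_append, or_imp, forall_and] at hj
    refine .cons (by simp) (pairwise_append_cons_iff.2 ⟨sorted, .nil, hj.1, by simp⟩)
      (List.disjoint_append_left.2 ⟨disjoint, List.singleton_disjoint.2 fun h => (hj.2 j h).false⟩)
      (fun v => (dominates v).trans (by simp)) tail
  | @there r t u h ih =>
    obtain _ | ⟨ne_nil, sorted, disjoint, dominates, tail⟩ := hS
    simp only [List.flatten_cons, List.mem_append, or_imp, forall_and] at hj
    refine .cons ne_nil sorted (fun z hz hzu => ?_)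
      (countLT_le_countLT_of_length_le hj.1 (length_headD_le_of_sortedGE hT)
        fun v hv => (h.countLT_headD_of_le hv).trans_le (dominates v))
      (ih tail hj.2 hT.isChain.of_cons.sortedGE)
    rcases h.mem_flatten_iff.1 hzu with rfl | hzt
    exacts [(hj.1 z hz).false, disjoint hz hzt]

theorem removeEntry_eq (h : AppendsEntry j S T) (hS : IsTableau S) (hj : j ∉ S.flatten) :
    removeEntry j T = S := by
  induction h with
  | nil => simp [removeEntry]
  | here r t =>
    obtain _ | ⟨ne_nil, -, -, -, tail⟩ := hS
    rw [List.flatten_cons, List.mem_append, not_or] at hj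
    rw [removeEntry_cons t (by rw [List.erase_append_right _ hj.1]; simp) ne_nil,
      removeEntry_of_notMem tail hj.2]
  | there r _ ih =>
    obtain _ | ⟨ne_nil, -, -, -, tail⟩ := hS
    rw [List.flatten_cons, List.mem_append, not_or] at hj
    rw [removeEntry_cons _ (List.erase_of_not_mem hj.1) ne_nil, ih tail hj.2]

theorem exists_of_mem_head {r : List ℕ} {t : List (List ℕ)} (hT : IsTableau (r :: t))
    (hle : ∀ z ∈ (r :: t).flatten, z ≤ j) (hj : j ∈ r) :
    ∃ S, AppendsEntry j S (r :: t) ∧ IsTableau S ∧ j ∉ S.flatten := by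
  have hT' := hT
  obtain _ | ⟨-, sorted, disjoint, dominates, tail⟩ := hT'
  simp only [List.flatten_cons, List.mem_append, or_imp, forall_and] at hle
  have hjt : j ∉ t.flatten := fun h => disjoint hj h
  obtain ⟨a, b, rfl⟩ := List.append_of_mem hj
  obtain ⟨-, -, haj, hjb⟩ := pairwise_append_cons_iff.1 sorted
  obtain rfl : b = [] := List.eq_nil_iff_forall_not_mem.2 fun z hz =>
    (hle.1 z (by simp [hz])).not_gt (hjb z hz)
  by_cases ha : a = []
  · subst ha
    obtain rfl : t = [] := tail.eq_nil_of_forall_notMem fun z hz => by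
      obtain ⟨w, hw, hwz⟩ := hT.exists_lt_of_mem hz
      exact (hle.2 z hz).not_gt (List.mem_singleton.1 hw ▸ hwz)
    exact ⟨[], .nil, .nil, by simp⟩
  · have ht : ∀ z ∈ t.headD [], z < j := fun z hz => by
      have hzt : z ∈ t.flatten := mem_flatten_of_mem_headD hz
      exact (hle.2 z hzt).lt_of_ne (ne_of_mem_of_not_mem hzt hjt)
    have hlen : (t.headD []).length ≤ a.length := by
      rw [← countLT_eq_length ht, ← countLT_eq_length haj]
      simpa using dominates j
    exact ⟨a :: t, .here a t, hT.of_append_singleton ha hlen⟩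

theorem exists_of_mem (hT : IsTableau T) (hle : ∀ z ∈ T.flatten, z ≤ j) (hj : j ∈ T.flatten) :
    ∃ S, AppendsEntry j S T ∧ IsTableau S ∧ j ∉ S.flatten := by
  induction hT with
  | nil => simp at hj
  | @cons r t ne_nil sorted disjoint dominates tail ih =>
    by_cases hjr : j ∈ r
    · exact exists_of_mem_head (.cons ne_nil sorted disjoint dominates tail) hle hjr
    · simp only [List.flatten_cons, List.mem_append, or_imp, forall_and] at hj hle
      obtain ⟨S, hSt, hS, hjS⟩ := ih hle.2 (hj.resolve_left hjr)
      refine ⟨r :: S, .there r hSt, .cons ne_nil sorted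
        (fun z hz hzS => disjoint hz (hSt.mem_flatten_iff.2 (.inr hzS)))
        (fun v => (hSt.countLT_headD_le v).trans (dominates v)) hS, ?_⟩
      rw [List.flatten_cons, List.mem_append, not_or]
      exact ⟨hjr, hjS⟩

end AppendsEntry

section RowLens

open YoungDiagram

variable {l m : List ℕ}

theorem AddsCell.exists_getD (h : AddsCell l m) :
    ∃ k, ∀ i, m.getD i 0 = l.getD i 0 + if i = k then 1 else 0 := by
  induction h with
  | nil => exact ⟨0, fun i => by cases i <;> simp⟩
  | here a l => exact ⟨0, fun i => by cases i <;> simp⟩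
  | there a _ ih =>
    obtain ⟨k, hk⟩ := ih
    exact ⟨k + 1, Nat.rec (by simp) fun i _ => by simpa using hk i⟩

theorem eq_nil_of_getD_zero_eq_zero (hl : ∀ a ∈ l, 0 < a) (h : l.getD 0 0 = 0) : l = [] := by
  cases l with
  | nil => rfl
  | cons a l => exact absurd h (hl a (by simp)).ne'

theorem eq_of_getD_eq (hl : ∀ a ∈ l, 0 < a) (hm : ∀ a ∈ m, 0 < a)
    (h : ∀ i, m.getD i 0 = l.getD i 0) : m = l := by
  induction l generalizing m with
  | nil => exact eq_nil_of_getD_zero_eq_zero hm (h 0)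
  | cons a l ih =>
    cases m with
    | nil => exact absurd (h 0).symm (hl a (by simp)).ne'
    | cons b m =>
      rw [List.forall_mem_cons] at hl hm
      rw [show b = a from h 0, ih hl.2 hm.2 fun i => h (i + 1)]

theorem addsCell_of_getD (hl : ∀ a ∈ l, 0 < a) (hm : ∀ a ∈ m, 0 < a) {k : ℕ}
    (h : ∀ i, m.getD i 0 = l.getD i 0 + if i = k then 1 else 0) : AddsCell l m := by
  induction k generalizing l m with
  | zero =>
    cases m with
    | nil => simpa using h 0
    | cons b m =>
      rw [List.forall_mem_cons] at hm
      cases l with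
      | nil =>
        obtain rfl : b = 1 := by simpa using h 0
        rw [eq_of_getD_eq (l := []) (by simp) hm.2 fun i => by simpa using h (i + 1)]
        exact .nil
      | cons a l =>
        rw [List.forall_mem_cons] at hl
        obtain rfl : b = a + 1 := by simpa using h 0
        rw [eq_of_getD_eq hl.2 hm.2 fun i => by simpa using h (i + 1)]
        exact .here a l
  | succ k ih =>
    have hhead : m.getD 0 0 = l.getD 0 0 := by simpa using h 0
    cases l with
    | nil =>
      obtain rfl := eq_nil_of_getD_zero_eq_zero hm hhead
      simpa using h (k + 1)
    | cons a l =>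
      cases m with
      | nil => exact absurd hhead.symm (hl a (by simp)).ne'
      | cons b m =>
        rw [List.forall_mem_cons] at hl hm
        obtain rfl : b = a := hhead
        exact .there b (ih hl.2 hm.2 fun i => by simpa using h (i + 1))

theorem getD_rowLens (μ : YoungDiagram) (i : ℕ) : μ.rowLens.getD i 0 = μ.rowLen i := by
  have hlen : i < μ.rowLens.length ↔ 0 < μ.rowLen i := by
    rw [length_rowLens, ← mem_iff_lt_colLen, mem_iff_lt_rowLen]
  by_cases h : i < μ.rowLens.length
  · rw [List.getD_eq_getElem _ _ h, get_rowLens]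
  · rw [List.getD_eq_default _ _ (not_lt.1 h), Nat.eq_zero_of_not_pos (mt hlen.2 h)]

theorem rowLens_injective : Function.Injective rowLens := fun _ _ h =>
  equivListRowLens.injective (Subtype.ext h)

theorem rowLens_bot : (⊥ : YoungDiagram).rowLens = [] := by
  rw [← List.length_eq_zero_iff, length_rowLens, ← Nat.le_zero, ← not_lt, ← mem_iff_lt_colLen]
  exact notMem_bot _

theorem addsSquare_iff_addsCell {l μ : YoungDiagram} :
    AddsSquare l μ ↔ AddsCell l.rowLens μ.rowLens := by
  constructor
  · rintro ⟨⟨k, q⟩, hc, hμ⟩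
    have hmem : ∀ i p, p < μ.rowLen i ↔ (i = k ∧ p = q) ∨ p < l.rowLen i := fun i p => by
      rw [← mem_iff_lt_rowLen, ← mem_iff_lt_rowLen, ← mem_cells, ← mem_cells, hμ,
        Finset.mem_insert, Prod.mk.injEq]
    rw [mem_cells, mem_iff_lt_rowLen] at hc
    refine addsCell_of_getD l.pos_of_mem_rowLens μ.pos_of_mem_rowLens (k := k) fun i => ?_
    rw [getD_rowLens, getD_rowLens]
    have hl := hmem i (l.rowLen i)
    have hl_succ := hmem i (l.rowLen i + 1)
    have hμ := hmem i (μ.rowLen i)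
    have hq := hmem i q
    split_ifs with hi
    · subst hi; omega
    · omega
  · intro h
    obtain ⟨k, hk⟩ := h.exists_getD
    simp only [getD_rowLens] at hk
    refine ⟨(k, l.rowLen k), ?_, ?_⟩
    · simp [mem_iff_lt_rowLen]
    · ext ⟨i, q⟩
      rw [mem_cells, mem_iff_lt_rowLen, Finset.mem_insert, mem_cells, mem_iff_lt_rowLen, hk,
        Prod.mk.injEq]
      split_ifs with h
      · subst h; omega
      · simp [h]

end RowLens

section Arcs

open Relation

theorem reflTransGen_total_of_leftUnique {α : Type*} {R : α → α → Prop} {i j k : α}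
    (hR : Relator.LeftUnique R) (hi : ReflTransGen R i k) (hj : ReflTransGen R j k) :
    ReflTransGen R i j ∨ ReflTransGen R j i := by
  have htotal := ReflTransGen.total_of_right_unique hR.flip (reflTransGen_swap.2 hi)
    (reflTransGen_swap.2 hj)
  exact (htotal.imp reflTransGen_swap.1 reflTransGen_swap.1).symm

variable {α : Type*} [LinearOrder α] {s : Finset α} {P Q : Finpartition s} {i j k : α}

/-- The arcs of a set partition of a finite subset of a linear order: the pairs of consecutive
elements of a block. -/
def IsArc (P : Finpartition s) (i j : α) : Prop :=
  i ∈ P.part j ∧ i < j ∧ ∀ k ∈ P.part j, k < j → k ≤ i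

theorem mem_part_comm : i ∈ P.part j ↔ j ∈ P.part i := by
  simp only [Finpartition.mem_part_iff_exists, and_comm]

theorem part_eq_part_of_mem_part (h : i ∈ P.part j) : P.part i = P.part j :=
  (P.mem_part_iff_part_eq_part (P.part_subset j h) (P.part_subset i (mem_part_comm.1 h))).1 h

namespace IsArc

theorem mem_left (h : IsArc P i j) : i ∈ s := P.part_subset j h.1

theorem mem_right (h : IsArc P i j) : j ∈ s := P.part_subset i (mem_part_comm.1 h.1)

theorem left_unique (h : IsArc P i k) (h' : IsArc P j k) : i = j :=
  le_antisymm (h'.2.2 i h.1 h.2.1) (h.2.2 j h'.1 h'.2.1)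

theorem right_unique (h : IsArc P i j) (h' : IsArc P i k) : j = k := by
  have hpart : P.part j = P.part k :=
    (part_eq_part_of_mem_part h.1).symm.trans (part_eq_part_of_mem_part h'.1)
  have hj : j ∈ P.part k := hpart ▸ P.mem_part_self.2 h.mem_right
  have hk : k ∈ P.part j := hpart ▸ P.mem_part_self.2 h'.mem_right
  by_contra hne
  rcases lt_or_gt_of_ne hne with hjk | hkj
  · exact (h'.2.2 j hj hjk).not_gt h.2.1
  · exact (h.2.2 k hk hkj).not_gt h'.2.1

end IsArc

theorem exists_isArc_left_of_mem_part (h : i ∈ P.part j) (hij : i < j) :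
    ∃ k, IsArc P k j ∧ i ≤ k := by
  have hne : ((P.part j).filter (· < j)).Nonempty := ⟨i, Finset.mem_filter.2 ⟨h, hij⟩⟩
  obtain ⟨hmem, hlt⟩ := Finset.mem_filter.1 (Finset.max'_mem _ hne)
  have hmax : ∀ k ∈ P.part j, k < j → k ≤ Finset.max' _ hne := fun k hk hkj =>
    Finset.le_max' _ k (Finset.mem_filter.2 ⟨hk, hkj⟩)
  exact ⟨_, ⟨hmem, hlt, hmax⟩, hmax i h hij⟩

theorem exists_isArc_right_of_mem_part (h : j ∈ P.part i) (hij : i < j) : ∃ k, IsArc P i k := by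
  have hne : ((P.part i).filter (i < ·)).Nonempty := ⟨j, Finset.mem_filter.2 ⟨h, hij⟩⟩
  obtain ⟨hmem, hlt⟩ := Finset.mem_filter.1 (Finset.min'_mem _ hne)
  refine ⟨_, mem_part_comm.1 hmem, hlt, fun k hk hkm => le_of_not_gt fun hik => hkm.not_ge ?_⟩
  rw [part_eq_part_of_mem_part hmem] at hk
  exact Finset.min'_le _ k (Finset.mem_filter.2 ⟨hk, hik⟩)

theorem reflTransGen_isArc_of_mem_part (h : i ∈ P.part j) (hij : i ≤ j) :
    ReflTransGen (IsArc P) i j := by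
  refine s.finite_toSet.isWF.induction (P := fun j => i ∈ P.part j → i ≤ j →
    ReflTransGen (IsArc P) i j) (P.part_subset i (mem_part_comm.1 h)) (fun j _ ih h hij => ?_) h hij
  rcases hij.eq_or_lt with rfl | hij
  · exact .refl
  · obtain ⟨k, hk, hik⟩ := exists_isArc_left_of_mem_part h hij
    rw [← part_eq_part_of_mem_part hk.1] at h
    exact (ih k hk.mem_left hk.2.1 h hik).tail hk

theorem mem_part_of_reflTransGen_isArc (hj : j ∈ s) (h : ReflTransGen (IsArc P) i j) :
    i ∈ P.part j := by
  induction h with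
  | refl => exact P.mem_part_self.2 hj
  | tail _ harc ih => exact part_eq_part_of_mem_part harc.1 ▸ ih harc.mem_left

theorem part_subset_part_of_isArc_eq (h : IsArc P = IsArc Q) (j : α) : P.part j ⊆ Q.part j := by
  intro i hi
  have hj := P.part_subset i (mem_part_comm.1 hi)
  rcases le_total i j with hij | hji
  · exact mem_part_of_reflTransGen_isArc hj (h ▸ reflTransGen_isArc_of_mem_part hi hij)
  · exact mem_part_comm.1 (mem_part_of_reflTransGen_isArc (P.part_subset j hi)
      (h ▸ reflTransGen_isArc_of_mem_part (mem_part_comm.1 hi) hji))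

theorem isArc_injective : Function.Injective (IsArc : Finpartition s → α → α → Prop) := by
  suffices parts_subset : ∀ P Q : Finpartition s, IsArc P = IsArc Q → P.parts ⊆ Q.parts from
    fun P Q h => Finpartition.ext ((parts_subset P Q h).antisymm (parts_subset Q P h.symm))
  intro P Q h b hb
  obtain ⟨j, hj⟩ := P.nonempty_of_mem_parts hb
  have hpart : P.part j = Q.part j := (part_subset_part_of_isArc_eq h j).antisymm
    (part_subset_part_of_isArc_eq h.symm j)
  rw [← P.part_eq_of_mem hb hj, hpart]
  exact Q.part_mem.2 (P.le hb hj)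

theorem exists_isArc_eq {R : α → α → Prop} (hmem : ∀ i j, R i j → i ∈ s ∧ j ∈ s)
    (hlt : ∀ i j, R i j → i < j) (hleft : Relator.LeftUnique R) (hright : Relator.RightUnique R) :
    ∃ P : Finpartition s, IsArc P = R := by
  classical
  have hle : ∀ {i j}, ReflTransGen R i j → i ≤ j := fun h => by
    induction h with
    | refl => exact le_rfl
    | tail _ h ih => exact ih.trans (hlt _ _ h).le
  let joined : Setoid α := ⟨Join (ReflTransGen R), equivalence_join_reflTransGen
    fun _ b _ hb hc => ⟨b, .refl, hright hb hc ▸ .refl⟩⟩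
  let P := Finpartition.ofSetSetoid joined s
  have hpart : ∀ {i j}, R i j → i ∈ P.part j := fun {i j} h =>
    (Finpartition.mem_part_ofSetSetoid_iff_rel s).2
      ⟨(hmem i j h).2, (hmem i j h).1, j, .refl, .single h⟩
  have hprev : ∀ {i j}, i ∈ P.part j → i < j → ∃ k, R k j ∧ i ≤ k := fun hi hij => by
    obtain ⟨-, -, m, hjm, him⟩ := (Finpartition.mem_part_ofSetSetoid_iff_rel s).1 hi
    rcases reflTransGen_total_of_leftUnique hleft him hjm with hij' | hji
    · rcases ReflTransGen.cases_tail hij' with rfl | ⟨k, hik, hkj⟩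
      · exact absurd hij (lt_irrefl _)
      · exact ⟨k, hkj, hle hik⟩
    · exact absurd (hle hji) hij.not_ge
  refine ⟨P, funext₂ fun i j => propext ⟨fun ⟨hi, hij, hmax⟩ => ?_, fun h => ?_⟩⟩
  · obtain ⟨k, hkj, hik⟩ := hprev hi hij
    rwa [hik.antisymm (hmax k (hpart hkj) (hlt k j hkj))]
  · refine ⟨hpart h, hlt i j h, fun k hk hkj => ?_⟩
    obtain ⟨m, hm, hkm⟩ := hprev hk hkj
    rwa [hleft h hm]

end Arcs

section Steps

variable {n : ℕ} {P : SetPartition n} {i j k : ℕ} (T : List (List ℕ))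

theorem deleteStep_of_isArc (h : IsArc P j k) : deleteStep P j T = removeEntry j T :=
  if_pos ⟨k, Finset.mem_filter.2 ⟨mem_part_comm.1 h.1, h.2.1⟩⟩

theorem deleteStep_of_not_isArc (h : ∀ k, ¬IsArc P j k) : deleteStep P j T = T := by
  refine if_neg fun ⟨i, hi⟩ => ?_
  obtain ⟨hmem, hlt⟩ := Finset.mem_filter.1 hi
  obtain ⟨k, hk⟩ := exists_isArc_right_of_mem_part hmem hlt
  exact h k hk

theorem insertStep_of_isArc (h : IsArc P i j) : insertStep P j T = rowInsert i T := by
  have hi : i ∈ (P.part j).filter fun i => i < j := Finset.mem_filter.2 ⟨h.1, h.2.1⟩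
  rw [insertStep, dif_pos ⟨i, hi⟩]
  congr 1
  exact Finset.max'_eq_iff _ _ _ |>.2 ⟨hi, fun k hk =>
    h.2.2 k (Finset.mem_filter.1 hk).1 (Finset.mem_filter.1 hk).2⟩

theorem insertStep_of_not_isArc (h : ∀ i, ¬IsArc P i j) : insertStep P j T = T := by
  refine dif_neg fun ⟨i, hi⟩ => ?_
  obtain ⟨hmem, hlt⟩ := Finset.mem_filter.1 hi
  obtain ⟨k, hk, -⟩ := exists_isArc_left_of_mem_part hmem hlt
  exact h k hk

end Steps

section InsertionSequences

/-- One step of an insertion sequence, read from left to right. An even step undoes a row insertion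
or does nothing, and step number `2 i + 1` appends the entry `i + 1` or does nothing. -/
def InsertionStep (m : ℕ) (S T : List (List ℕ)) : Prop :=
  S = T ∨ (Even m ∧ ∃ x ∉ T.flatten, S = rowInsert x T) ∨
    ∃ i, m = 2 * i + 1 ∧ AppendsEntry (i + 1) S T

/-- The sequences of tableaux, starting with `∅` and equal to `∅` from index `2 n` on, which arise
by reading a set partition of `{1, …, n}`. -/
structure IsInsertionSequence (n : ℕ) (T : ℕ → List (List ℕ)) : Prop where
  zero : T 0 = []
  eq_nil_of_le : ∀ m, 2 * n ≤ m → T m = []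
  isTableau : ∀ m, IsTableau (T m)
  step : ∀ m, InsertionStep m (T m) (T (m + 1))

/-- The arcs of an insertion sequence: `i` is inserted between the indices `2 j - 1` and
`2 j - 2`. -/
def InsertionArc (T : ℕ → List (List ℕ)) (i j : ℕ) : Prop :=
  ∃ l, j = l + 1 ∧ i ∈ (T (2 * l)).flatten ∧ i ∉ (T (2 * l + 1)).flatten

namespace InsertionStep

variable {m i z : ℕ} {S T T' : List (List ℕ)}

theorem mem_of_mem (h : InsertionStep m S T) (hz : z ∈ T.flatten) (hzm : 2 * z ≤ m) :
    z ∈ S.flatten := by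
  rcases h with rfl | ⟨-, x, -, rfl⟩ | ⟨i, rfl, h⟩
  · exact hz
  · exact mem_flatten_rowInsert.2 (.inr hz)
  · exact (h.mem_flatten_iff.1 hz).resolve_left (by omega)

theorem mem_or_eq_of_mem (h : InsertionStep m S T) (hz : z ∈ T.flatten) :
    z ∈ S.flatten ∨ m + 1 = 2 * z := by
  rcases h with rfl | ⟨-, x, -, rfl⟩ | ⟨i, rfl, h⟩
  · exact .inl hz
  · exact .inl (mem_flatten_rowInsert.2 (.inr hz))
  · exact (h.mem_flatten_iff.1 hz).symm.imp_right (by omega)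

theorem even_of_mem_of_notMem (h : InsertionStep m S T) (hzS : z ∈ S.flatten)
    (hzT : z ∉ T.flatten) : Even m ∧ S = rowInsert z T := by
  rcases h with rfl | ⟨hm, x, -, rfl⟩ | ⟨i, rfl, h⟩
  · exact absurd hzS hzT
  · obtain rfl := (mem_flatten_rowInsert.1 hzS).resolve_right hzT
    exact ⟨hm, rfl⟩
  · exact absurd (h.mem_flatten_iff.2 (.inr hzS)) hzT

theorem eq_of_forall_mem (h : InsertionStep (2 * i) S T) (hST : ∀ z ∈ S.flatten, z ∈ T.flatten) :
    S = T := by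
  rcases h with rfl | ⟨-, x, hx, rfl⟩ | ⟨k, hk, -⟩
  · rfl
  · exact absurd (hST x (mem_flatten_rowInsert.2 (.inl rfl))) hx
  · omega

theorem eq_of_notMem (h : InsertionStep (2 * i + 1) S T) (hT : i + 1 ∉ T.flatten) : S = T := by
  rcases h with rfl | ⟨hi, -⟩ | ⟨k, hk, h⟩
  · rfl
  · exact absurd hi (by simp)
  · obtain rfl : i = k := by omega
    exact absurd (h.mem_flatten_iff.2 (.inl rfl)) hT

theorem eq_removeEntry (h : InsertionStep (2 * i + 1) S T) (hS : IsTableau S)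
    (hi : i + 1 ∉ S.flatten) : S = removeEntry (i + 1) T := by
  rcases h with rfl | ⟨hi, -⟩ | ⟨k, hk, h⟩
  · exact (removeEntry_of_notMem hS hi).symm
  · exact absurd hi (by simp)
  · obtain rfl : i = k := by omega
    exact (h.removeEntry_eq hS hi).symm

theorem right_unique (h : InsertionStep m S T) (h' : InsertionStep m S T') (hT : IsTableau T)
    (hT' : IsTableau T') (hl : rowLengths T = rowLengths T') : T = T' := by
  rcases h with rfl | ⟨hm, x, -, rfl⟩ | ⟨i, rfl, h⟩ <;>
    rcases h' with rfl | ⟨hm', x', -, hS⟩ | ⟨k, hk, h'⟩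
  · rfl
  · exact absurd (hl.symm.trans (congrArg _ hS)) (addsCell_rowInsert _ _).ne
  · exact absurd hl h'.addsCell.ne
  · exact absurd hl (addsCell_rowInsert _ _).ne
  · exact (rowInsert_inj hT hT' hl hS).2
  · exact absurd hm (by simp [hk])
  · exact absurd hl.symm h.addsCell.ne
  · exact absurd hm' (by simp)
  · obtain rfl : i = k := by omega
    exact h.unique h' hl

end InsertionStep

namespace IsInsertionSequence

variable {n m a b i j z : ℕ} {T T' : ℕ → List (List ℕ)}

theorem pos_and_two_mul_le_of_mem (hT : IsInsertionSequence n T) (hz : z ∈ (T m).flatten) :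
    0 < z ∧ 2 * z ≤ m := by
  induction m with
  | zero => simp [hT.zero] at hz
  | succ m ih =>
    rcases (hT.step m).mem_or_eq_of_mem hz with hz | hz
    · have := ih hz
      omega
    · omega

theorem mem_of_mem (hT : IsInsertionSequence n T) (hz : z ∈ (T b).flatten) (hza : 2 * z ≤ a)
    (hab : a ≤ b) : z ∈ (T a).flatten := by
  induction b, hab using Nat.le_induction with
  | base => exact hz
  | succ b hab ih => exact ih ((hT.step b).mem_of_mem hz (hza.trans hab))

theorem insertionArc_lt (hT : IsInsertionSequence n T) (h : InsertionArc T i j) : i < j := by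
  obtain ⟨l, rfl, hi, -⟩ := h
  have := hT.pos_and_two_mul_le_of_mem hi
  omega

theorem insertionArc_mem_Icc (hT : IsInsertionSequence n T) (h : InsertionArc T i j) :
    i ∈ Finset.Icc 1 n ∧ j ∈ Finset.Icc 1 n := by
  obtain ⟨l, rfl, hi, -⟩ := h
  have hbound := hT.pos_and_two_mul_le_of_mem hi
  have hl : l < n := by
    by_contra hl
    simp [hT.eq_nil_of_le (2 * l) (by omega)] at hi
  simp only [Finset.mem_Icc]
  omega

theorem insertionArc_leftUnique (hT : IsInsertionSequence n T) :
    Relator.LeftUnique (InsertionArc T) := by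
  rintro i k _ ⟨l, rfl, hi, hi'⟩ ⟨l', hl, hk, hk'⟩
  obtain rfl : l = l' := by omega
  rw [((hT.step _).even_of_mem_of_notMem hi hi').2] at hk
  exact ((mem_flatten_rowInsert.1 hk).resolve_right hk').symm

theorem insertionArc_rightUnique (hT : IsInsertionSequence n T) :
    Relator.RightUnique (InsertionArc T) := by
  suffices not_lt : ∀ {i j k}, InsertionArc T i j → InsertionArc T i k → ¬j < k from
    fun i j k hj hk =>
      le_antisymm (Nat.le_of_not_lt (not_lt hk hj)) (Nat.le_of_not_lt (not_lt hj hk))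
  rintro i _ _ ⟨l, rfl, hi, hi'⟩ ⟨l', rfl, hk, -⟩ hlt
  have := hT.pos_and_two_mul_le_of_mem hi
  exact hi' (hT.mem_of_mem hk (by omega) (by omega))

theorem exists_insertionArc_of_mem (hT : IsInsertionSequence n T) (hz : z ∈ (T m).flatten) :
    ∃ j, InsertionArc T z j := by
  by_contra! hno
  have hstay : ∀ k, z ∈ (T (m + k)).flatten := fun k => by
    induction k with
    | zero => exact hz
    | succ k ih =>
      by_contra hnot
      obtain ⟨l, hl⟩ := even_iff_two_dvd.1 ((hT.step (m + k)).even_of_mem_of_notMem ih hnot).1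
      exact hno (l + 1) ⟨l, rfl, hl ▸ ih, hl ▸ hnot⟩
  exact absurd (hstay (2 * n)) (by simp [hT.eq_nil_of_le (m + 2 * n) (by omega)])

theorem eq_of_rowLengths_eq (hT : IsInsertionSequence n T) (hT' : IsInsertionSequence n T')
    (h : ∀ m, rowLengths (T m) = rowLengths (T' m)) : T = T' := by
  funext m
  induction m with
  | zero => rw [hT.zero, hT'.zero]
  | succ m ih =>
    exact (hT.step m).right_unique (ih ▸ hT'.step m) (hT.isTableau _) (hT'.isTableau _) (h _)

end IsInsertionSequence

end InsertionSequences

section CDDSYTableau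

variable {n : ℕ} (P : SetPartition n) {i m z : ℕ} {T : List (List ℕ)}

theorem cddsyTableau_odd (i : ℕ) :
    cddsyTableau P (2 * i + 1) = deleteStep P (i + 1) (cddsyTableau P (2 * i + 2)) := by
  rw [cddsyTableau, if_neg (by omega), cddsyTableau, if_pos (by omega),
    show (2 * i + 1) / 2 = i by omega, show (2 * i + 2) / 2 = i + 1 by omega]

theorem cddsyTableau_even (hi : i < n) :
    cddsyTableau P (2 * i) = insertStep P (i + 1) (cddsyTableau P (2 * i + 1)) := by
  rw [cddsyTableau_odd, cddsyTableau, if_pos (by omega), cddsyTableau, if_pos (by omega),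
    show n - 2 * i / 2 = (n - (i + 1)) + 1 by omega, cddsyRead,
    show (2 * i + 2) / 2 = i + 1 by omega, show n - (n - (i + 1)) = i + 1 by omega]

theorem cddsyTableau_of_le (hm : 2 * n ≤ m) : cddsyTableau P m = [] := by
  rw [cddsyTableau, show n - m / 2 = 0 by omega, show n - (m / 2 + 1) = 0 by omega, cddsyRead,
    deleteStep, removeEntry]
  simp only [List.map_nil, List.filter_nil, ite_self]

/-- The entries of the `m`-th tableau of a set partition, in terms of its arcs: the left endpoints
already passed by the index `m` (where `2 z ≤ m`) of the arcs still open there. -/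
def IsOpenAt (P : SetPartition n) (m z : ℕ) : Prop :=
  2 * z ≤ m ∧ ∃ k, IsArc P z k ∧ m + 1 < 2 * k

/-- `T` can occur at index `m` of the reading of `P`. -/
structure IsReadingAt (P : SetPartition n) (m : ℕ) (T : List (List ℕ)) : Prop where
  isTableau : IsTableau T
  mem_flatten_iff : ∀ z, z ∈ T.flatten ↔ IsOpenAt P m z

variable {P}

theorem isOpenAt_even_iff :
    IsOpenAt P (2 * i) z ↔ IsOpenAt P (2 * i + 1) z ∨ IsArc P z (i + 1) := by
  constructor
  · rintro ⟨hz, k, harc, hk⟩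
    obtain rfl | hne := eq_or_ne k (i + 1)
    · exact .inr harc
    · exact .inl ⟨by omega, k, harc, by omega⟩
  · rintro (⟨hz, k, harc, hk⟩ | harc)
    · exact ⟨by omega, k, harc, by omega⟩
    · have := harc.2.1
      exact ⟨by omega, i + 1, harc, by omega⟩

theorem IsArc.not_isOpenAt (h : IsArc P z (i + 1)) : ¬IsOpenAt P (2 * i + 1) z := by
  rintro ⟨-, k, hk, hlt⟩
  obtain rfl := hk.right_unique h
  omega

theorem isOpenAt_add_two_iff : IsOpenAt P (2 * i + 2) z ↔
    (z = i + 1 ∧ ∃ k, IsArc P (i + 1) k) ∨ IsOpenAt P (2 * i + 1) z := by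
  constructor
  · rintro ⟨hz, k, harc, hk⟩
    obtain rfl | hne := eq_or_ne z (i + 1)
    · exact .inl ⟨rfl, k, harc⟩
    · exact .inr ⟨by omega, k, harc, by omega⟩
  · rintro (⟨rfl, k, harc⟩ | ⟨hz, k, harc, hk⟩)
    · have := harc.2.1
      exact ⟨by omega, k, harc, by omega⟩
    · exact ⟨by omega, k, harc, by omega⟩

theorem IsReadingAt.nil (hm : 2 * n ≤ m) : IsReadingAt P m [] := by
  refine ⟨.nil, fun z => ⟨fun hz => absurd hz (by simp), fun ⟨_, k, harc, hk⟩ => ?_⟩⟩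
  have := (Finset.mem_Icc.1 harc.mem_right).2
  omega

theorem IsReadingAt.insertStep (hT : IsReadingAt P (2 * i + 1) T) :
    IsReadingAt P (2 * i) (insertStep P (i + 1) T) ∧
      InsertionStep (2 * i) (insertStep P (i + 1) T) T := by
  by_cases h : ∃ x, IsArc P x (i + 1)
  · obtain ⟨x, hx⟩ := h
    have hxT : x ∉ T.flatten := fun hmem => hx.not_isOpenAt ((hT.mem_flatten_iff x).1 hmem)
    rw [insertStep_of_isArc T hx]
    refine ⟨⟨isTableau_rowInsert hT.isTableau hxT, fun z => ?_⟩,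
      .inr (.inl ⟨even_two_mul i, x, hxT, rfl⟩)⟩
    have harc : IsArc P z (i + 1) ↔ z = x := ⟨fun hz => hz.left_unique hx, fun hz => hz ▸ hx⟩
    rw [mem_flatten_rowInsert, hT.mem_flatten_iff, isOpenAt_even_iff, harc, or_comm]
  · push Not at h
    rw [insertStep_of_not_isArc T h]
    refine ⟨⟨hT.isTableau, fun z => ?_⟩, .inl rfl⟩
    rw [hT.mem_flatten_iff, isOpenAt_even_iff, or_iff_left (h z)]

theorem IsReadingAt.deleteStep (hT : IsReadingAt P (2 * i + 2) T) :
    IsReadingAt P (2 * i + 1) (deleteStep P (i + 1) T) ∧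
      InsertionStep (2 * i + 1) (deleteStep P (i + 1) T) T := by
  have hmem : ∀ z, z ∈ T.flatten ↔ (z = i + 1 ∧ ∃ k, IsArc P (i + 1) k) ∨
      IsOpenAt P (2 * i + 1) z := fun z => (hT.mem_flatten_iff z).trans isOpenAt_add_two_iff
  by_cases h : ∃ k, IsArc P (i + 1) k
  · have hle : ∀ z ∈ T.flatten, z ≤ i + 1 := fun z hz => by
      have := ((hT.mem_flatten_iff z).1 hz).1
      omega
    obtain ⟨S, hST, hS, hiS⟩ :=
      AppendsEntry.exists_of_mem hT.isTableau hle ((hmem _).2 (.inl ⟨rfl, h⟩))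
    rw [deleteStep_of_isArc T h.choose_spec, hST.removeEntry_eq hS hiS]
    refine ⟨⟨hS, fun z => ?_⟩, .inr (.inr ⟨i, rfl, hST⟩)⟩
    have hi : ¬IsOpenAt P (2 * i + 1) (i + 1) := fun hopen => by
      have := hopen.1
      omega
    have hz := hST.mem_flatten_iff.symm.trans (hmem z)
    obtain rfl | hne := eq_or_ne z (i + 1)
    · exact iff_of_false hiS hi
    · simpa only [hne, false_and, false_or] using hz
  · rw [deleteStep_of_not_isArc T (not_exists.1 h)]
    refine ⟨⟨hT.isTableau, fun z => ?_⟩, .inl rfl⟩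
    rw [hmem, or_iff_right (fun hz => h hz.2)]

variable (P)

theorem isReadingAt_cddsyTableau (m : ℕ) : IsReadingAt P m (cddsyTableau P m) ∧
    InsertionStep m (cddsyTableau P m) (cddsyTableau P (m + 1)) := by
  rcases le_or_gt (2 * n) m with hm | hm
  · rw [cddsyTableau_of_le P hm, cddsyTableau_of_le P (hm.trans m.le_succ)]
    exact ⟨.nil hm, .inl rfl⟩
  · have ih := (isReadingAt_cddsyTableau (m + 1)).1
    obtain ⟨i, rfl | rfl⟩ := Nat.even_or_odd' m
    · rw [cddsyTableau_even P (by omega)]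
      exact ih.insertStep
    · rw [cddsyTableau_odd]
      exact ih.deleteStep
termination_by 2 * n - m

theorem isInsertionSequence_cddsyTableau : IsInsertionSequence n (cddsyTableau P) where
  zero := by
    have hread := (isReadingAt_cddsyTableau P 0).1
    refine hread.isTableau.eq_nil_of_forall_notMem fun z hz => ?_
    obtain ⟨hz, k, harc, -⟩ := (hread.mem_flatten_iff z).1 hz
    have := (Finset.mem_Icc.1 harc.mem_left).1
    omega
  eq_nil_of_le _ hm := cddsyTableau_of_le P hm
  isTableau m := (isReadingAt_cddsyTableau P m).1.isTableau
  step m := (isReadingAt_cddsyTableau P m).2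

theorem insertionArc_cddsyTableau : InsertionArc (cddsyTableau P) = IsArc P := by
  funext x j
  refine propext ⟨fun ⟨i, hj, hx, hx'⟩ => ?_, fun h => ?_⟩
  · rw [(isReadingAt_cddsyTableau P _).1.mem_flatten_iff] at hx hx'
    exact hj ▸ (isOpenAt_even_iff.1 hx).resolve_left hx'
  · obtain ⟨i, rfl⟩ := Nat.exists_eq_add_of_lt (Nat.zero_lt_of_lt h.2.1)
    rw [zero_add] at h ⊢
    refine ⟨i, rfl, ?_, ?_⟩ <;> rw [(isReadingAt_cddsyTableau P _).1.mem_flatten_iff]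
    · exact isOpenAt_even_iff.2 (.inr h)
    · exact h.not_isOpenAt

variable {P}

namespace IsInsertionSequence

variable {T : ℕ → List (List ℕ)}

theorem eq_deleteStep (hT : IsInsertionSequence n T) (hP : IsArc P = InsertionArc T) (i : ℕ) :
    T (2 * i + 1) = deleteStep P (i + 1) (T (2 * i + 2)) := by
  by_cases h : ∃ k, IsArc P (i + 1) k
  · rw [deleteStep_of_isArc _ h.choose_spec]
    refine (hT.step (2 * i + 1)).eq_removeEntry (hT.isTableau _) fun hi => ?_
    have := (hT.pos_and_two_mul_le_of_mem hi).2
    omega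
  · rw [deleteStep_of_not_isArc _ (not_exists.1 h)]
    exact (hT.step (2 * i + 1)).eq_of_notMem fun hi => h (hP ▸ hT.exists_insertionArc_of_mem hi)

theorem eq_insertStep (hT : IsInsertionSequence n T) (hP : IsArc P = InsertionArc T) (i : ℕ) :
    T (2 * i) = insertStep P (i + 1) (T (2 * i + 1)) := by
  by_cases h : ∃ x, IsArc P x (i + 1)
  · obtain ⟨x, harc⟩ := h
    obtain ⟨l, hl, hx, hx'⟩ : InsertionArc T x (i + 1) := hP ▸ harc
    obtain rfl : i = l := by omega
    rw [insertStep_of_isArc _ harc]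
    exact ((hT.step (2 * i)).even_of_mem_of_notMem hx hx').2
  · rw [insertStep_of_not_isArc _ (not_exists.1 h)]
    refine (hT.step (2 * i)).eq_of_forall_mem fun z hz => ?_
    by_contra hz'
    exact h ⟨z, hP ▸ ⟨i, rfl, hz, hz'⟩⟩

theorem eq_cddsyTableau (hT : IsInsertionSequence n T) (hP : IsArc P = InsertionArc T) (m : ℕ) :
    T m = cddsyTableau P m := by
  rcases le_or_gt (2 * n) m with hm | hm
  · rw [hT.eq_nil_of_le m hm, cddsyTableau_of_le P hm]
  · have ih := eq_cddsyTableau hT hP (m + 1)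
    obtain ⟨i, rfl | rfl⟩ := Nat.even_or_odd' m
    · rw [hT.eq_insertStep hP, cddsyTableau_even P (by omega), ih]
    · rw [hT.eq_deleteStep hP, cddsyTableau_odd, ih]
termination_by 2 * n - m

theorem exists_eq_cddsyTableau (hT : IsInsertionSequence n T) :
    ∃ P : SetPartition n, T = cddsyTableau P := by
  obtain ⟨P, hP⟩ := exists_isArc_eq (fun i j => hT.insertionArc_mem_Icc)
    (fun i j => hT.insertionArc_lt) hT.insertionArc_leftUnique hT.insertionArc_rightUnique
  exact ⟨P, funext (hT.eq_cddsyTableau hP)⟩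

end IsInsertionSequence

theorem cddsyTableau_injective :
    Function.Injective (cddsyTableau : SetPartition n → ℕ → List (List ℕ)) := fun P Q h =>
  isArc_injective (by rw [← insertionArc_cddsyTableau P, h, insertionArc_cddsyTableau])

end CDDSYTableau

section CDDSYMap

variable {n m : ℕ}

/-- The step condition from the `m`-th to the `(m + 1)`-th partition of a vacillating tableau: a
square may be deleted if `m` is even, and added if `m` is odd. -/
def IsVacillatingStep (m : ℕ) (l μ : YoungDiagram) : Prop :=
  μ = l ∨ (Even m ∧ AddsSquare μ l) ∨ (Odd m ∧ AddsSquare l μ)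

theorem isVacillatingStep_two_mul {i : ℕ} {l μ : YoungDiagram} :
    IsVacillatingStep (2 * i) l μ ↔ μ = l ∨ AddsSquare μ l := by
  simp [IsVacillatingStep, Nat.not_odd_iff_even.2 (even_two_mul i)]

theorem isVacillatingStep_two_mul_add_one {i : ℕ} {l μ : YoungDiagram} :
    IsVacillatingStep (2 * i + 1) l μ ↔ μ = l ∨ AddsSquare l μ := by
  simp [IsVacillatingStep, parity_simps]

namespace VacillatingTableau

/-- The partition `λᵐ` of a vacillating tableau of empty shape, extended by `∅` beyond the end of
the sequence so that the step conditions hold at all indices. -/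
def shapeAt (V : VacillatingTableau n ⊥) (m : ℕ) : YoungDiagram :=
  if h : m < 2 * n + 1 then V.shape ⟨m, h⟩ else ⊥

variable (V : VacillatingTableau n ⊥)

theorem shapeAt_of_lt (h : m < 2 * n + 1) : V.shapeAt m = V.shape ⟨m, h⟩ := dif_pos h

theorem shapeAt_zero : V.shapeAt 0 = ⊥ := (V.shapeAt_of_lt (by omega)).trans V.shape_zero

theorem shapeAt_of_le (h : 2 * n ≤ m) : V.shapeAt m = ⊥ := by
  rcases h.eq_or_lt with rfl | h
  · exact (V.shapeAt_of_lt (by omega)).trans V.shape_last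
  · exact dif_neg (by omega)

theorem shapeAt_step (m : ℕ) : IsVacillatingStep m (V.shapeAt m) (V.shapeAt (m + 1)) := by
  rcases le_or_gt (2 * n) m with hm | hm
  · exact .inl (by rw [V.shapeAt_of_le hm, V.shapeAt_of_le (hm.trans m.le_succ)])
  · rw [V.shapeAt_of_lt (by omega), V.shapeAt_of_lt (by omega)]
    obtain ⟨i, rfl | rfl⟩ := Nat.even_or_odd' m
    · exact isVacillatingStep_two_mul.2 (V.odd_step ⟨i, by omega⟩)
    · exact isVacillatingStep_two_mul_add_one.2 (V.even_step ⟨i, by omega⟩)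

end VacillatingTableau

theorem IsVacillatingStep.exists_insertionStep {S : List (List ℕ)} {l μ : YoungDiagram}
    (h : IsVacillatingStep m l μ) (hS : IsTableau S) (hle : ∀ z ∈ S.flatten, 2 * z ≤ m)
    (hl : rowLengths S = l.rowLens) :
    ∃ T, (IsTableau T ∧ (∀ z ∈ T.flatten, 2 * z ≤ m + 1) ∧ rowLengths T = μ.rowLens) ∧
      InsertionStep m S T := by
  rcases h with rfl | ⟨hm, h⟩ | ⟨⟨i, rfl⟩, h⟩
  · exact ⟨S, ⟨hS, fun z hz => (hle z hz).trans m.le_succ, hl⟩, .inl rfl⟩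
  · rw [addsSquare_iff_addsCell, ← hl] at h
    obtain ⟨x, T, rfl, hT, hx, hTμ⟩ := exists_rowInsert_eq h μ.rowLens_sorted
      (fun _ => μ.pos_of_mem_rowLens _) hS
    exact ⟨T, ⟨hT, fun z hz => (hle z (mem_flatten_rowInsert.2 (.inr hz))).trans m.le_succ, hTμ⟩,
      .inr (.inl ⟨hm, x, hx, rfl⟩)⟩
  · rw [addsSquare_iff_addsCell, ← hl] at h
    obtain ⟨T, hST, hTμ⟩ := AppendsEntry.exists_of_addsCell (i + 1) h
    refine ⟨T, ⟨hST.isTableau hS (fun z hz => ?_) (hTμ ▸ μ.rowLens_sorted), fun z hz => ?_, hTμ⟩,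
      .inr (.inr ⟨i, rfl, hST⟩)⟩
    · have := hle z hz
      omega
    · rcases hST.mem_flatten_iff.1 hz with rfl | hz
      · omega
      · exact (hle z hz).trans (Nat.le_succ _)

theorem exists_seq_of_step {α : Type*} {Inv : ℕ → α → Prop} {R : ℕ → α → α → Prop} {a : α}
    (ha : Inv 0 a) (hstep : ∀ m a, Inv m a → ∃ b, Inv (m + 1) b ∧ R m a b) :
    ∃ f : ℕ → α, f 0 = a ∧ ∀ m, Inv m (f m) ∧ R m (f m) (f (m + 1)) := by
  choose! next hInv hR using hstep
  have hf : ∀ m, Inv m (Nat.rec a next m) := fun m => by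
    induction m with
    | zero => exact ha
    | succ m ih => exact hInv m _ ih
  exact ⟨fun m => Nat.rec a next m, rfl, fun m => ⟨hf m, hR m _ (hf m)⟩⟩

theorem VacillatingTableau.exists_isInsertionSequence (V : VacillatingTableau n ⊥) :
    ∃ T, IsInsertionSequence n T ∧ ∀ m, rowLengths (T m) = (V.shapeAt m).rowLens := by
  obtain ⟨T, hzero, hT⟩ := exists_seq_of_step (a := [])
    (Inv := fun m T => IsTableau T ∧ (∀ z ∈ T.flatten, 2 * z ≤ m) ∧
      rowLengths T = (V.shapeAt m).rowLens)
    ⟨.nil, by simp, by rw [V.shapeAt_zero, rowLens_bot, rowLengths_nil]⟩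
    fun m S ⟨hS, hle, hl⟩ => (V.shapeAt_step m).exists_insertionStep hS hle hl
  refine ⟨T, ⟨hzero, fun m hm => ?_, fun m => (hT m).1.1, fun m => (hT m).2⟩,
    fun m => (hT m).1.2.2⟩
  rw [← rowLengths_eq_nil, (hT m).1.2.2, V.shapeAt_of_le hm, rowLens_bot]

theorem InsertionStep.rowLengths_eq_or_addsCell {S T : List (List ℕ)} (h : InsertionStep m S T) :
    rowLengths T = rowLengths S ∨ (Even m ∧ AddsCell (rowLengths T) (rowLengths S)) ∨
      (Odd m ∧ AddsCell (rowLengths S) (rowLengths T)) := by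
  rcases h with rfl | ⟨hm, x, -, rfl⟩ | ⟨i, rfl, h⟩
  · exact .inl rfl
  · exact .inr (.inl ⟨hm, addsCell_rowInsert x T⟩)
  · exact .inr (.inr ⟨odd_two_mul_add_one i, h.addsCell⟩)

/-- The shape of the `m`-th tableau of a set partition, as a Young diagram. -/
def cddsyShape (P : SetPartition n) (m : ℕ) : YoungDiagram :=
  .ofRowLens (rowLengths (cddsyTableau P m))
    ((isInsertionSequence_cddsyTableau P).isTableau m).rowLengths_sorted

theorem rowLens_cddsyShape (P : SetPartition n) (m : ℕ) :
    (cddsyShape P m).rowLens = rowLengths (cddsyTableau P m) :=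
  YoungDiagram.rowLens_ofRowLens_eq_self fun {_} =>
    ((isInsertionSequence_cddsyTableau P).isTableau m).rowLengths_pos _

theorem cddsyShape_step (P : SetPartition n) (m : ℕ) :
    IsVacillatingStep m (cddsyShape P m) (cddsyShape P (m + 1)) := by
  simp only [IsVacillatingStep, addsSquare_iff_addsCell, ← rowLens_injective.eq_iff,
    rowLens_cddsyShape]
  exact ((isInsertionSequence_cddsyTableau P).step m).rowLengths_eq_or_addsCell

theorem cddsyShape_eq_bot {P : SetPartition n} (h : cddsyTableau P m = []) :
    cddsyShape P m = ⊥ :=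
  rowLens_injective (by rw [rowLens_cddsyShape, h, rowLengths_nil, rowLens_bot])

/-- The Chen–Deng–Du–Stanley–Yan map `φ`. -/
def cddsyMap (P : SetPartition n) : VacillatingTableau n ⊥ where
  shape m := cddsyShape P m
  shape_zero := cddsyShape_eq_bot (isInsertionSequence_cddsyTableau P).zero
  shape_last := cddsyShape_eq_bot (cddsyTableau_of_le P le_rfl)
  odd_step i := isVacillatingStep_two_mul.1 (cddsyShape_step P (2 * i))
  even_step i := isVacillatingStep_two_mul_add_one.1 (cddsyShape_step P (2 * i + 1))

theorem isCDDSYMap_cddsyMap : IsCDDSYMap (cddsyMap (n := n)) := fun P m => rowLens_cddsyShape P m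

theorem shapeAt_cddsyMap (P : SetPartition n) (m : ℕ) :
    (cddsyMap P).shapeAt m = cddsyShape P m := by
  rcases lt_or_ge m (2 * n + 1) with hm | hm
  · exact (cddsyMap P).shapeAt_of_lt hm
  · rw [(cddsyMap P).shapeAt_of_le (by omega),
      cddsyShape_eq_bot (cddsyTableau_of_le P (by omega))]

theorem cddsyMap_bijective : Function.Bijective (cddsyMap (n := n)) := by
  refine ⟨fun P Q h => cddsyTableau_injective ?_, fun V => ?_⟩
  · refine (isInsertionSequence_cddsyTableau P).eq_of_rowLengths_eq
      (isInsertionSequence_cddsyTableau Q) fun m => ?_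
    rw [← rowLens_cddsyShape, ← rowLens_cddsyShape, ← shapeAt_cddsyMap, ← shapeAt_cddsyMap, h]
  · obtain ⟨T, hT, hV⟩ := V.exists_isInsertionSequence
    obtain ⟨P, rfl⟩ := hT.exists_eq_cddsyTableau
    refine ⟨P, VacillatingTableau.ext (funext fun m => rowLens_injective ?_)⟩
    exact (rowLens_cddsyShape P m).trans ((hV m).trans (by rw [V.shapeAt_of_lt m.2]))

end CDDSYMap

section FixedPoints

variable {n m : ℕ} {l μ : YoungDiagram}

theorem mem_oneSquare {c : ℕ × ℕ} : c ∈ oneSquare ↔ c = (0, 0) := by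
  rw [← YoungDiagram.mem_cells, oneSquare, Finset.mem_singleton]

theorem zero_mem_of_mem {c : ℕ × ℕ} (h : c ∈ μ) : (0, 0) ∈ μ :=
  μ.up_left_mem c.1.zero_le c.2.zero_le h

theorem eq_bot_of_zero_notMem (h : (0, 0) ∉ μ) : μ = ⊥ :=
  SetLike.ext fun c => iff_of_false (h <| zero_mem_of_mem ·) (YoungDiagram.notMem_bot c)

theorem oneSquare_ne_bot : oneSquare ≠ ⊥ := fun h =>
  YoungDiagram.notMem_bot (0, 0) (h ▸ mem_oneSquare.2 rfl)

theorem oneSquare_transpose : oneSquare.transpose = oneSquare :=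
  SetLike.ext fun c => by
    rw [YoungDiagram.mem_transpose, mem_oneSquare, mem_oneSquare, Prod.swap_eq_iff_eq_swap,
      Prod.swap_prod_mk]

theorem addsSquare_iff_mem : AddsSquare l μ ↔ ∃ c ∉ l, ∀ x, x ∈ μ ↔ x = c ∨ x ∈ l := by
  simp only [AddsSquare, Finset.ext_iff, Finset.mem_insert, YoungDiagram.mem_cells]

theorem not_addsSquare_bot : ¬AddsSquare l ⊥ := fun h => by
  obtain ⟨c, -, h⟩ := addsSquare_iff_mem.1 h
  exact YoungDiagram.notMem_bot c ((h c).2 (.inl rfl))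

theorem addsSquare_bot_iff : AddsSquare ⊥ μ ↔ μ = oneSquare := by
  simp only [addsSquare_iff_mem, YoungDiagram.notMem_bot, not_false_eq_true, true_and, or_false]
  refine ⟨fun ⟨c, h⟩ => ?_, fun h => ⟨(0, 0), fun x => h ▸ mem_oneSquare⟩⟩
  obtain rfl : (0, 0) = c := (h _).1 (zero_mem_of_mem ((h c).2 rfl))
  exact SetLike.ext fun x => (h x).trans mem_oneSquare.symm

theorem addsSquare_oneSquare_iff : AddsSquare l oneSquare ↔ l = ⊥ := by
  refine ⟨fun h => ?_, fun h => h ▸ addsSquare_bot_iff.2 rfl⟩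
  obtain ⟨c, hc, h⟩ := addsSquare_iff_mem.1 h
  obtain rfl := mem_oneSquare.1 ((h c).2 (.inl rfl))
  exact eq_bot_of_zero_notMem hc

theorem not_addsSquare_oneSquare_of_transpose_eq (hμ : μ.transpose = μ) :
    ¬AddsSquare oneSquare μ := fun h => by
  obtain ⟨⟨a, b⟩, hc, h⟩ := addsSquare_iff_mem.1 h
  have hab : (a, b) ∈ μ := (h _).2 (.inl rfl)
  have hba : (b, a) ∈ μ := by rwa [← hμ, YoungDiagram.mem_transpose]
  have h0b : (0, b) ∈ μ := μ.up_left_mem a.zero_le le_rfl hab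
  simp only [h, mem_oneSquare, Prod.mk.injEq] at hc hba h0b
  omega

/-- A partition is flat if it is `∅` or `(1)`. -/
def IsFlat (μ : YoungDiagram) : Prop := μ = ⊥ ∨ μ = oneSquare

theorem IsFlat.transpose_eq (h : IsFlat μ) : μ.transpose = μ := by
  rcases h with rfl | rfl
  exacts [YoungDiagram.transpose_bot', oneSquare_transpose]

theorem IsVacillatingStep.isFlat (h : IsVacillatingStep m l μ) (hl : IsFlat l)
    (hμ : μ.transpose = μ) : IsFlat μ := by
  rcases h, hl with ⟨rfl | ⟨-, h⟩ | ⟨-, h⟩, rfl | rfl⟩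
  · exact .inl rfl
  · exact .inr rfl
  · exact absurd h not_addsSquare_bot
  · exact .inl (addsSquare_oneSquare_iff.1 h)
  · exact .inr (addsSquare_bot_iff.1 h)
  · exact absurd h (not_addsSquare_oneSquare_of_transpose_eq hμ)

theorem conjugateTableau_involutive (n : ℕ) : Function.Involutive (conjugateTableau (n := n)) :=
  fun V => VacillatingTableau.ext (funext fun m => (V.shape m).transpose_transpose)

theorem conjugateTableau_eq_self_iff {V : VacillatingTableau n ⊥} :
    conjugateTableau V = V ↔ ∀ m, (V.shapeAt m).transpose = V.shapeAt m := by
  refine ⟨fun h m => ?_, fun h => VacillatingTableau.ext (funext fun m => ?_)⟩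
  · rcases lt_or_ge m (2 * n + 1) with hm | hm
    · rw [V.shapeAt_of_lt hm]
      exact congrFun (congrArg VacillatingTableau.shape h) ⟨m, hm⟩
    · rw [V.shapeAt_of_le (by omega), YoungDiagram.transpose_bot']
  · have := h m
    rwa [V.shapeAt_of_lt m.2] at this

theorem mem_flatTableaux_iff {V : VacillatingTableau n ⊥} :
    V ∈ flatTableaux n ↔ ∀ m, IsFlat (V.shapeAt m) := by
  refine ⟨fun h m => ?_, fun h m => V.shapeAt_of_lt m.2 ▸ h m⟩
  rcases lt_or_ge m (2 * n + 1) with hm | hm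
  · exact V.shapeAt_of_lt hm ▸ h ⟨m, hm⟩
  · exact .inl (V.shapeAt_of_le (by omega))

theorem fixedPoints_conjugateTableau (n : ℕ) :
    Function.fixedPoints (conjugateTableau (n := n)) = flatTableaux n := by
  ext V
  rw [Function.mem_fixedPoints_iff, conjugateTableau_eq_self_iff, mem_flatTableaux_iff]
  refine ⟨fun h m => ?_, fun h m => (h m).transpose_eq⟩
  induction m with
  | zero => exact .inl V.shapeAt_zero
  | succ m ih => exact (V.shapeAt_step m).isFlat ih (h (m + 1))

end FixedPoints

section Motzkin

variable {n i : ℕ} {l μ : YoungDiagram}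

theorem isVacillatingStep_two_mul_iff_of_isFlat (hl : IsFlat l) (hμ : IsFlat μ) :
    IsVacillatingStep (2 * i) l μ ↔ (l = ⊥ → μ = ⊥) := by
  rw [isVacillatingStep_two_mul]
  rcases hl, hμ with ⟨rfl | rfl, rfl | rfl⟩ <;>
    simp [oneSquare_ne_bot, not_addsSquare_bot, addsSquare_bot_iff, oneSquare_ne_bot.symm]

theorem isVacillatingStep_two_mul_add_one_iff_of_isFlat (hl : IsFlat l) (hμ : IsFlat μ) :
    IsVacillatingStep (2 * i + 1) l μ ↔ (μ = ⊥ → l = ⊥) := by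
  rw [isVacillatingStep_two_mul_add_one]
  rcases hl, hμ with ⟨rfl | rfl, rfl | rfl⟩ <;>
    simp [oneSquare_ne_bot, not_addsSquare_bot, addsSquare_bot_iff, oneSquare_ne_bot.symm]

theorem shapeAt_ne_bot_of_odd {V : VacillatingTableau n ⊥} (hV : V ∈ flatTableaux n)
    (h : V.shapeAt (2 * i + 1) ≠ ⊥) :
    V.shapeAt (2 * i) ≠ ⊥ ∧ V.shapeAt (2 * i + 2) ≠ ⊥ := by
  have hflat := mem_flatTableaux_iff.1 hV
  exact ⟨mt ((isVacillatingStep_two_mul_iff_of_isFlat (hflat _) (hflat _)).1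
      (V.shapeAt_step _)) h,
    mt ((isVacillatingStep_two_mul_add_one_iff_of_isFlat (hflat _) (hflat _)).1
      (V.shapeAt_step _)) h⟩

theorem flatTableaux_ext {V W : VacillatingTableau n ⊥} (hV : V ∈ flatTableaux n)
    (hW : W ∈ flatTableaux n)
    (h : ∀ m < 2 * n + 1, V.shapeAt m ≠ ⊥ ↔ W.shapeAt m ≠ ⊥) : V = W := by
  refine VacillatingTableau.ext (funext fun m => ?_)
  have hm := h m m.2
  rw [V.shapeAt_of_lt m.2, W.shapeAt_of_lt m.2] at hm
  rcases hV m, hW m with ⟨hv | hv, hw | hw⟩ <;> simp_all [oneSquare_ne_bot]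

open Classical in
theorem exists_flatTableau {A : ℕ → Prop} (hzero : ¬A 0) (hlast : ¬A (2 * n))
    (hstep : ∀ i < n, A (2 * i + 1) → A (2 * i) ∧ A (2 * i + 2)) :
    ∃ V ∈ flatTableaux n, ∀ m < 2 * n + 1, V.shapeAt m ≠ ⊥ ↔ A m := by
  have hflat (m : ℕ) : IsFlat (if A m then oneSquare else ⊥) := (ite_eq_or_eq _ _ _).symm
  have hbot {m : ℕ} : (if A m then oneSquare else ⊥) = ⊥ ↔ ¬A m := by
    simp [oneSquare_ne_bot]
  refine ⟨⟨fun m => if A m then oneSquare else ⊥, if_neg hzero, if_neg hlast, fun i => ?_,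
    fun i => ?_⟩, fun m => hflat m, fun m hm => ?_⟩
  · rw [← isVacillatingStep_two_mul (i := i),
      isVacillatingStep_two_mul_iff_of_isFlat (hflat _) (hflat _), hbot, hbot]
    exact mt fun h => (hstep i i.2 h).1
  · rw [← isVacillatingStep_two_mul_add_one (i := i),
      isVacillatingStep_two_mul_add_one_iff_of_isFlat (hflat _) (hflat _), hbot, hbot]
    exact mt fun h => (hstep i i.2 h).2
  · rw [VacillatingTableau.shapeAt_of_lt _ hm, Ne, hbot, not_not]

namespace ColouredMotzkinPath

theorem eq_of_height_label_iff {M N : ColouredMotzkinPath n}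
    (hheight : ∀ i, M.height i = 1 ↔ N.height i = 1)
    (hlabel : ∀ i, M.label i = some 0 ↔ N.label i = some 0) : M = N := by
  have eq_of_iff : ∀ a b : Option (Fin 2), (a.isSome ↔ b.isSome) → (a = some 0 ↔ b = some 0) →
      a = b := by decide
  refine ColouredMotzkinPath.ext (funext fun i => ?_) (funext fun i => eq_of_iff _ _ ?_ (hlabel i))
  · have := M.height_le i
    have := N.height_le i
    have := hheight i
    omega
  · rw [M.label_isSome, N.label_isSome, hheight, hheight]

/-- `M.IsOccupied m` says that the `m`-th partition of the vacillating tableau of the path `M` is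
`(1)`: it is read off the heights for even `m`, and off the labels for odd `m`. -/
def IsOccupied (M : ColouredMotzkinPath n) (m : ℕ) : Prop :=
  (∃ i : Fin (n + 1), m = 2 * i ∧ M.height i = 1) ∨
    ∃ i : Fin n, m = 2 * i + 1 ∧ M.label i = some 0

theorem isOccupied_two_mul (M : ColouredMotzkinPath n) (i : Fin (n + 1)) :
    M.IsOccupied (2 * i) ↔ M.height i = 1 := by
  refine ⟨?_, fun h => .inl ⟨i, rfl, h⟩⟩
  rintro (⟨j, hj, h⟩ | ⟨j, hj, -⟩)
  · rwa [Fin.ext (by omega : (i : ℕ) = j)]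
  · omega

theorem isOccupied_two_mul_add_one (M : ColouredMotzkinPath n) (i : Fin n) :
    M.IsOccupied (2 * i + 1) ↔ M.label i = some 0 := by
  refine ⟨?_, fun h => .inr ⟨i, rfl, h⟩⟩
  rintro (⟨j, hj, -⟩ | ⟨j, hj, h⟩)
  · omega
  · rwa [Fin.ext (by omega : (i : ℕ) = j)]

theorem IsOccupied.neighbours {M : ColouredMotzkinPath n} (hi : i < n)
    (h : M.IsOccupied (2 * i + 1)) : M.IsOccupied (2 * i) ∧ M.IsOccupied (2 * i + 2) := by
  have hlabel := (M.isOccupied_two_mul_add_one ⟨i, hi⟩).1 h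
  have hheight := (M.label_isSome ⟨i, hi⟩).1 (by rw [hlabel, Option.isSome_some])
  exact hheight.imp (M.isOccupied_two_mul (Fin.castSucc ⟨i, hi⟩)).2
    (M.isOccupied_two_mul (Fin.succ ⟨i, hi⟩)).2

end ColouredMotzkinPath

theorem toMotzkin_height_eq_one_iff (V : flatTableaux n) (i : Fin (n + 1)) :
    (toMotzkin V).height i = 1 ↔ V.1.shapeAt (2 * i) ≠ ⊥ := by
  rw [V.1.shapeAt_of_lt (by omega)]
  simp [toMotzkin]

theorem toMotzkin_label_eq_some_zero_iff (V : flatTableaux n) (i : Fin n) :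
    (toMotzkin V).label i = some 0 ↔ V.1.shapeAt (2 * i + 1) ≠ ⊥ := by
  have h := shapeAt_ne_bot_of_odd V.2 (i := i)
  rw [V.1.shapeAt_of_lt (by omega), V.1.shapeAt_of_lt (by omega),
    V.1.shapeAt_of_lt (by omega)] at h
  rw [V.1.shapeAt_of_lt (by omega)]
  simpa [toMotzkin] using h

theorem toMotzkin_injective : Function.Injective (toMotzkin (n := n)) := by
  refine fun V W h => Subtype.ext (flatTableaux_ext V.2 W.2 fun m hm => ?_)
  obtain ⟨i, rfl | rfl⟩ := Nat.even_or_odd' m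
  · rw [← toMotzkin_height_eq_one_iff V ⟨i, by omega⟩, h, toMotzkin_height_eq_one_iff]
  · rw [← toMotzkin_label_eq_some_zero_iff V ⟨i, by omega⟩, h, toMotzkin_label_eq_some_zero_iff]

theorem toMotzkin_surjective : Function.Surjective (toMotzkin (n := n)) := fun M => by
  obtain ⟨V, hV, hVM⟩ := exists_flatTableau (n := n) (A := M.IsOccupied)
    ((M.isOccupied_two_mul 0).not.2 (by rw [M.height_zero]; exact zero_ne_one))
    ((M.isOccupied_two_mul (Fin.last n)).not.2 (by rw [M.height_last]; exact zero_ne_one))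
    (fun i hi => ColouredMotzkinPath.IsOccupied.neighbours hi)
  refine ⟨⟨V, hV⟩, ColouredMotzkinPath.eq_of_height_label_iff (fun i => ?_) fun i => ?_⟩
  · rw [toMotzkin_height_eq_one_iff, hVM _ (by omega), M.isOccupied_two_mul]
  · rw [toMotzkin_label_eq_some_zero_iff, hVM _ (by omega), M.isOccupied_two_mul_add_one]

end Motzkin

section StepSequences

variable {α : Type*}

/-- The sequences `a = f 0, …, f m = b` whose `i`-th step `f i, f (i + 1)` is allowed by `R i`. -/
def stepSequences (R : ℕ → α → α → Prop) (a : α) (m : ℕ) (b : α) : Set (Fin (m + 1) → α) :=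
  {f | f 0 = a ∧ f (Fin.last m) = b ∧ ∀ i : Fin m, R i (f i.castSucc) (f i.succ)}

variable {R : ℕ → α → α → Prop} {a b : α} {m : ℕ}

theorem stepSequences_zero_self : stepSequences R a 0 a = {fun _ => a} := by
  ext f
  refine ⟨fun h => funext fun i => (congrArg f (Fin.fin_one_eq_zero i)).trans h.1, ?_⟩
  rintro rfl
  exact ⟨rfl, rfl, fun i => i.elim0⟩

theorem stepSequences_zero_of_ne (hab : a ≠ b) : stepSequences R a 0 b = ∅ :=
  Set.eq_empty_of_forall_notMem fun _ h => hab (h.1.symm.trans h.2.1)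

theorem snoc_mem_stepSequences {f : Fin (m + 1) → α} {c : α} :
    Fin.snoc (α := fun _ => α) f c ∈ stepSequences R a (m + 1) b ↔
      c = b ∧ f ∈ stepSequences R a m (f (Fin.last m)) ∧ R m (f (Fin.last m)) c := by
  have hzero : Fin.snoc (α := fun _ => α) f c 0 = f 0 := Fin.snoc_castSucc (i := 0) ..
  simp only [stepSequences, Set.mem_ofPred_eq, hzero, Fin.snoc_last, Fin.forall_fin_succ',
    Fin.snoc_castSucc, Fin.succ_castSucc, Fin.succ_last, Fin.val_castSucc, Fin.val_last]
  tauto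

theorem stepSequences_succ : stepSequences R a (m + 1) b =
    ⋃ c ∈ {c | R m c b}, (Fin.snoc (α := fun _ => α) · b) '' stepSequences R a m c := by
  ext f
  induction f using Fin.snocCases with | _ f c
  simp only [snoc_mem_stepSequences, Set.mem_iUnion, Set.mem_image, Set.mem_ofPred_eq,
    Fin.snoc_inj, exists_prop]
  constructor
  · rintro ⟨rfl, hf, hR⟩
    exact ⟨_, hR, f, hf, rfl, rfl⟩
  · rintro ⟨d, hR, f, hf, rfl, rfl⟩
    obtain rfl : f (Fin.last m) = d := hf.2.1
    exact ⟨rfl, hf, hR⟩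

theorem encard_stepSequences_succ (h : {c | R m c b}.Finite) :
    (stepSequences R a (m + 1) b).encard =
      ∑ᶠ c ∈ {c | R m c b}, (stepSequences R a m c).encard := by
  have hinj := Fin.snoc_left_injective (n := m + 1) (α := fun _ => α) b
  rw [stepSequences_succ, h.encard_biUnion]
  · exact finsum_mem_congr rfl fun c _ => hinj.encard_image _
  · intro c _ d _ hcd
    rw [Function.onFun, Set.disjoint_image_iff hinj]
    exact Set.disjoint_left.2 fun f hf hf' => hcd (hf.2.1.symm.trans hf'.2.1)

end StepSequences

section Counting

variable {n i : ℕ}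

/-- The vacillating steps between the partitions `∅` and `(1)`. -/
def IsFlatStep (m : ℕ) (l μ : YoungDiagram) : Prop :=
  IsFlat l ∧ IsFlat μ ∧ IsVacillatingStep m l μ

theorem isFlat_bot : IsFlat ⊥ := .inl rfl

theorem isFlat_oneSquare : IsFlat oneSquare := .inr rfl

theorem setOf_isFlatStep_two_mul_bot : {l | IsFlatStep (2 * i) l ⊥} = {⊥, oneSquare} :=
  Set.ext fun _ => ⟨And.left, fun h =>
    ⟨h, isFlat_bot, (isVacillatingStep_two_mul_iff_of_isFlat h isFlat_bot).2 fun _ => rfl⟩⟩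

theorem setOf_isFlatStep_two_mul_oneSquare :
    {l | IsFlatStep (2 * i) l oneSquare} = {oneSquare} := by
  refine Set.ext fun l => ⟨fun h => h.1.resolve_left fun hl => ?_, ?_⟩
  · exact oneSquare_ne_bot ((isVacillatingStep_two_mul_iff_of_isFlat h.1 h.2.1).1 h.2.2 hl)
  · rintro rfl
    exact ⟨isFlat_oneSquare, isFlat_oneSquare, .inl rfl⟩

theorem setOf_isFlatStep_two_mul_add_one_bot : {l | IsFlatStep (2 * i + 1) l ⊥} = {⊥} := by
  refine Set.ext fun l => ⟨fun h => ?_, ?_⟩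
  · exact (isVacillatingStep_two_mul_add_one_iff_of_isFlat h.1 h.2.1).1 h.2.2 rfl
  · rintro rfl
    exact ⟨isFlat_bot, isFlat_bot, .inl rfl⟩

theorem setOf_isFlatStep_two_mul_add_one_oneSquare :
    {l | IsFlatStep (2 * i + 1) l oneSquare} = {⊥, oneSquare} :=
  Set.ext fun _ => ⟨And.left, fun h => ⟨h, isFlat_oneSquare,
    (isVacillatingStep_two_mul_add_one_iff_of_isFlat h isFlat_oneSquare).2
      fun hbot => absurd hbot oneSquare_ne_bot⟩⟩

/-- The number of sequences of length `m` of vacillating steps from `∅` to `μ` through the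
partitions `∅` and `(1)`. -/
noncomputable def flatCount (m : ℕ) (μ : YoungDiagram) : ℕ∞ :=
  (stepSequences IsFlatStep ⊥ m μ).encard

theorem flatCount_zero_bot : flatCount 0 ⊥ = 1 := by
  rw [flatCount, stepSequences_zero_self, Set.encard_singleton]

theorem flatCount_zero_oneSquare : flatCount 0 oneSquare = 0 := by
  rw [flatCount, stepSequences_zero_of_ne oneSquare_ne_bot.symm, Set.encard_empty]

theorem flatCount_succ (m : ℕ) (μ : YoungDiagram) :
    flatCount (m + 1) μ = ∑ᶠ l ∈ {l | IsFlatStep m l μ}, flatCount m l :=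
  encard_stepSequences_succ <| (Set.toFinite {⊥, oneSquare}).subset fun _ h => h.1

theorem flatCount_two_mul_add_one_bot (i : ℕ) :
    flatCount (2 * i + 1) ⊥ = flatCount (2 * i) ⊥ + flatCount (2 * i) oneSquare := by
  rw [flatCount_succ, setOf_isFlatStep_two_mul_bot, finsum_mem_pair oneSquare_ne_bot.symm]

theorem flatCount_two_mul_add_one_oneSquare (i : ℕ) :
    flatCount (2 * i + 1) oneSquare = flatCount (2 * i) oneSquare := by
  rw [flatCount_succ, setOf_isFlatStep_two_mul_oneSquare, finsum_mem_singleton]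

theorem flatCount_two_mul_add_two_bot (i : ℕ) :
    flatCount (2 * i + 2) ⊥ = flatCount (2 * i + 1) ⊥ := by
  rw [flatCount_succ, setOf_isFlatStep_two_mul_add_one_bot, finsum_mem_singleton]

theorem flatCount_two_mul_add_two_oneSquare (i : ℕ) : flatCount (2 * i + 2) oneSquare =
    flatCount (2 * i + 1) ⊥ + flatCount (2 * i + 1) oneSquare := by
  rw [flatCount_succ, setOf_isFlatStep_two_mul_add_one_oneSquare,
    finsum_mem_pair oneSquare_ne_bot.symm]

theorem flatCount_two_mul_add_one_eq_fib (n : ℕ) :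
    flatCount (2 * n + 1) ⊥ = Nat.fib (2 * n + 1) ∧
      flatCount (2 * n + 1) oneSquare = Nat.fib (2 * n) := by
  induction n with
  | zero =>
    rw [flatCount_two_mul_add_one_bot, flatCount_two_mul_add_one_oneSquare, Nat.mul_zero,
      flatCount_zero_bot, flatCount_zero_oneSquare]
    simp
  | succ n ih =>
    rw [flatCount_two_mul_add_one_bot, flatCount_two_mul_add_one_oneSquare, Nat.mul_succ,
      flatCount_two_mul_add_two_bot, flatCount_two_mul_add_two_oneSquare, ih.1, ih.2]
    simp only [Nat.fib_add_two (n := 2 * n), Nat.fib_add_two (n := 2 * n + 1), Nat.cast_add]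
    constructor <;> ring

theorem image_shape_flatTableaux :
    VacillatingTableau.shape '' flatTableaux n = stepSequences IsFlatStep ⊥ (2 * n) ⊥ := by
  ext f
  constructor
  · rintro ⟨V, hV, rfl⟩
    refine ⟨V.shape_zero, V.shape_last, fun i => ⟨hV _, hV _, ?_⟩⟩
    have := V.shapeAt_step i
    rwa [V.shapeAt_of_lt (by omega), V.shapeAt_of_lt (by omega)] at this
  · rintro ⟨hzero, hlast, hstep⟩
    refine ⟨⟨f, hzero, hlast, fun i => ?_, fun i => ?_⟩, fun i => ?_, rfl⟩
    · exact isVacillatingStep_two_mul.1 (hstep ⟨2 * i, by omega⟩).2.2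
    · exact isVacillatingStep_two_mul_add_one.1 (hstep ⟨2 * i + 1, by omega⟩).2.2
    · induction i using Fin.cases with
      | zero => exact .inl hzero
      | succ i => exact (hstep i).2.1

theorem encard_flatTableaux (n : ℕ) : (flatTableaux n).encard = flatCount (2 * n) ⊥ := by
  rw [flatCount, ← image_shape_flatTableaux,
    Function.Injective.encard_image fun _ _ => VacillatingTableau.ext]

theorem ncard_flatTableaux_zero : (flatTableaux 0).ncard = 1 := by
  rw [Set.ncard, encard_flatTableaux, Nat.mul_zero, flatCount_zero_bot, ENat.toNat_one]

theorem ncard_flatTableaux_succ (n : ℕ) :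
    (flatTableaux (n + 1)).ncard = Nat.fib (2 * n + 1) := by
  rw [Set.ncard, encard_flatTableaux, Nat.mul_succ, flatCount_two_mul_add_two_bot,
    (flatCount_two_mul_add_one_eq_fib n).1, ENat.toNat_natCast]

theorem oddFib_succ (n : ℕ) : oddFib (n + 1) = Nat.fib (2 * n + 1) := by
  induction n using Nat.twoStepInduction with
  | zero => simp [oddFib]
  | one => simp [oddFib, Nat.fib_add_two]
  | more n ih₁ ih₂ =>
    rw [oddFib, ih₁, ih₂]
    simp only [Nat.mul_succ, Nat.fib_add_two (n := 2 * n + 1), Nat.fib_add_two (n := 2 * n + 2),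
      Nat.fib_add_two (n := 2 * n + 3), Nat.cast_add]
    ring

theorem ncard_flatTableaux_eq_oddFib (n : ℕ) : ((flatTableaux n).ncard : ℤ) = oddFib n := by
  cases n with
  | zero => rw [ncard_flatTableaux_zero, oddFib, Nat.cast_one]
  | succ n => rw [ncard_flatTableaux_succ, oddFib_succ]

end Counting

section Conjugation

variable {α β : Type*} (φ : α ≃ β) {τ : β → β}

theorem involutive_symm_comp_comp (hτ : Function.Involutive τ) :
    Function.Involutive (φ.symm ∘ τ ∘ φ) := fun a => by
  simp only [Function.comp_apply, Equiv.apply_symm_apply, hτ (φ a), Equiv.symm_apply_apply]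

theorem ncard_fixedPoints_symm_comp_comp :
    (Function.fixedPoints (φ.symm ∘ τ ∘ φ)).ncard = (Function.fixedPoints τ).ncard := by
  have himage : φ '' Function.fixedPoints (φ.symm ∘ τ ∘ φ) = Function.fixedPoints τ := by
    ext b
    simp [Equiv.image_eq_preimage_symm, Function.IsFixedPt]
  rw [← himage, Set.ncard_image_of_injective _ φ.injective]

end Conjugation

theorem mainTheorem10 (n : ℕ) :
    (∃ φ : SetPartition n ≃ VacillatingTableau n ⊥,
      IsCDDSYMap φ ∧
      Function.Involutive (φ.symm ∘ conjugateTableau ∘ φ) ∧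
      ((Function.fixedPoints (φ.symm ∘ conjugateTableau ∘ φ)).ncard : ℤ) = oddFib n ∧
      (1 ≤ n →
        (Function.fixedPoints (φ.symm ∘ conjugateTableau ∘ φ)).ncard = Nat.fib (2 * n - 1))) ∧
    Function.fixedPoints (conjugateTableau (n := n)) = flatTableaux n ∧
    Function.Bijective (toMotzkin (n := n)) := by
  refine ⟨⟨.ofBijective cddsyMap cddsyMap_bijective, isCDDSYMap_cddsyMap,
    involutive_symm_comp_comp _ (conjugateTableau_involutive n), ?_, fun hn => ?_⟩,
    fixedPoints_conjugateTableau n, toMotzkin_injective, toMotzkin_surjective⟩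
  · rw [ncard_fixedPoints_symm_comp_comp, fixedPoints_conjugateTableau,
      ncard_flatTableaux_eq_oddFib]
  · obtain ⟨m, rfl⟩ := Nat.exists_eq_add_of_le' hn
    rw [ncard_fixedPoints_symm_comp_comp, fixedPoints_conjugateTableau,
      ncard_flatTableaux_succ, Nat.mul_succ, Nat.add_succ_sub_one]
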